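/- Let $G=(V,E)$ be a finite simple graph on $n=|V|$ vertices with maximum degree $\Delta$ and adjacency matrix $A_G$, whose smallest eigenvalue is $\lambda_{\min}(A_G)$. Let $k$ be an integer with $1\le k\le n$ and $k\,(\Delta+|\lambda_{\min}(A_G)|)\le n$ (that is, $k\le n/(\Delta+|\lambda_{\min}(A_G)|)$ if $G$ has an edge, in which case $k\le n$ is automatic; if $G$ has no edges, only $1\le k\le n$ is required). Let $\mathcal I_k$ be the set of independent sets of $G$ with exactly $k$ vertices. The down-up walk $P$ on $\mathcal I_k$ is the Markov chain that in one step moves from $S\in\mathcal I_k$ by deleting a uniformly random vertex $u\in S$ and then moving to a uniformly random set in $\mathcal I_k$ containing $S\setminus\{u\}$; equivalently, $P=U D$, where $U$ and $D$ are the up and down operators between the faces of sizes $k-1$ and $k$ of the simplicial complex of independent sets of size at most $k$, weighted by the uniform distribution on $\mathcal I_k$. For $\varepsilon>0$ let $$T(\varepsilon,P)=\min\Big\{t\in\mathbb N_{\ge 0}:\ \sum_{S'\in\mathcal I_k}\Big|P^t(S,S')-\tfrac1{|\mathcal I_k|}\Big|\le\varepsilon\ \text{ for all } S\in\mathcal I_k\Big\},\qquad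 B=k^2\Big(\log\tfrac1\varepsilon+k\log n\Big).$$ Then $\mathcal I_k\neq\emptyset$, and for every $\varepsilon>0$ the minimum is attained (so that after $T(\varepsilon,P)$ steps the walk, from any starting set, is $\varepsilon$-close in $\ell_1$ to the uniform distribution on $\mathcal I_k$) and $$T(\varepsilon,P)\le\max(0,\lceil B\rceil).$$ If moreover $\varepsilon\le 1$, then $$T(\varepsilon,P)\le k^2\Big(\log\tfrac1\varepsilon+k\log n\Big),$$ except possibly when $n=2$, $k=1$ and $2/e<\varepsilon<1$. -/

import Mathlib

open Finset

/-- An abstract simplicial complex on a finite ground set: a downward closed collection of finite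
sets. The empty set may be a face; it is the unique face of dimension `-1`. -/
structure FaceComplex (V : Type*) where
  faces : Finset (Finset V)
  down_closed : ∀ β ∈ faces, ∀ α, α ⊆ β → α ∈ faces

namespace FaceComplex

variable {V : Type*} [DecidableEq V]

/-- The faces with exactly `c` elements, i.e. the faces of dimension `c - 1`. -/
def level (X : FaceComplex V) (c : ℕ) : Finset (Finset V) :=
  X.faces.filter fun α => α.card = c

/-- The marginals of a weight `μ` on the top faces, indexed by codimension: codimension `0` is `μ`
itself, and for a face `α` of dimension `j` (so that `α.card + 1 = j + 2`),
`Π_j(α) = (1 / (j + 2)) * ∑_{β ∈ X(j+1), β ⊇ α} Π_{j+1}(β)`. -/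
noncomputable def marginal (X : FaceComplex V) (μ : Finset V → ℝ) : ℕ → Finset V → ℝ
  | 0, α => μ α
  | i + 1, α => (1 / ((α.card : ℝ) + 1)) *
      ∑ β ∈ (X.level (α.card + 1)).filter (fun β => α ⊆ β), marginal X μ i β

/-- The weight that `μ`, given on the faces with `m` elements, induces on the faces with `c ≤ m`
elements. -/
noncomputable def levelWeight (X : FaceComplex V) (m : ℕ) (μ : Finset V → ℝ) (c : ℕ) :
    Finset V → ℝ :=
  X.marginal μ (m - c)

/-- The up operator, from functions on the faces with `c - 1` elements to functions on the faces
with `c` elements: `(U f)(β) = (1 / c) * ∑_{α ⊆ β} f(α)`. As a random walk acting on distributions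
from the left, it deletes a uniformly random element of `β`. -/
noncomputable def upOp (X : FaceComplex V) (c : ℕ) :
    Matrix {β // β ∈ X.level c} {α // α ∈ X.level (c - 1)} ℝ :=
  Matrix.of fun β α => if α.1 ⊆ β.1 then 1 / (c : ℝ) else 0

/-- The down operator, from functions on the faces with `c` elements to functions on the faces with
`c - 1` elements: `(D g)(α) = ∑_{β ⊇ α} Π(β) g(β) / (c * Π(α))`. As a random walk it moves from `α`
to a random face `β ⊇ α`. -/
noncomputable def downOp (X : FaceComplex V) (m : ℕ) (μ : Finset V → ℝ) (c : ℕ) :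
    Matrix {α // α ∈ X.level (c - 1)} {β // β ∈ X.level c} ℝ :=
  Matrix.of fun α β =>
    if α.1 ⊆ β.1 then X.levelWeight m μ c β.1 / ((c : ℝ) * X.levelWeight m μ (c - 1) α.1) else 0

/-- The down-up walk on the faces with `c ≥ 1` elements (that is, the `(c - 1)`-th down-up walk) of
the complex `X` with weight `μ` on its faces with `m` elements. -/
noncomputable def downUpWalk (X : FaceComplex V) (m : ℕ) (μ : Finset V → ℝ) (c : ℕ) :
    Matrix {β // β ∈ X.level c} {β // β ∈ X.level c} ℝ :=
  X.upOp c * X.downOp m μ c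

end FaceComplex

/-- The uniform distribution on a finite set `A`. -/
noncomputable def uniformOn {β : Type*} [DecidableEq β] (A : Finset β) : β → ℝ :=
  fun x => if x ∈ A then 1 / (A.card : ℝ) else 0

/-- Two distributions are `ε`-close if their `ℓ₁` distance is at most `ε`. -/
def EpsClose {ι : Type*} [Fintype ι] (ε : ℝ) (p q : ι → ℝ) : Prop :=
  ∑ x, |p x - q x| ≤ ε

/-- The mixing time of the random walk `P` towards the distribution `π`: the least `t` such that,
from every starting point `x`, the distribution `P ^ t (x, ·)` is `ε`-close to `π`. (It is meaningful
only if such a `t` exists.) -/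
noncomputable def mixingTime {ι : Type*} [Fintype ι] [DecidableEq ι] (ε : ℝ) (P : Matrix ι ι ℝ)
    (π : ι → ℝ) : ℕ :=
  sInf {t : ℕ | ∀ x, EpsClose ε ((P ^ t) x) π}

namespace SimpleGraph

variable {V : Type*} [Fintype V] [DecidableEq V] (G : SimpleGraph V) [DecidableRel G.Adj]

/-- The complex of all independent sets of `G` with at most `k` elements. -/
def independentSetComplex (k : ℕ) : FaceComplex V where
  faces := (univ : Finset (Finset V)).filter fun S => S.card ≤ k ∧ G.IsIndepSet (S : Set V)
  down_closed := by
    intro β hβ α hαβ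
    simp only [mem_filter, mem_univ, true_and] at hβ ⊢
    exact ⟨(card_le_card hαβ).trans hβ.1, hβ.2.mono (coe_subset.mpr hαβ)⟩

/-- The `(k - 1)`-th down-up walk on the complex of independent sets with at most `k` elements,
weighted by the uniform distribution on the independent sets with `k` elements. -/
noncomputable def independentSetWalk (k : ℕ) :
    Matrix {S // S ∈ (G.independentSetComplex k).level k}
      {S // S ∈ (G.independentSetComplex k).level k} ℝ :=
  (G.independentSetComplex k).downUpWalk k (uniformOn ((G.independentSetComplex k).level k)) k

/-- The smallest eigenvalue of the adjacency matrix (for a nonempty vertex set). -/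
noncomputable def lambdaMin : ℝ :=
  ⨅ i, (show (G.adjMatrix ℝ).IsHermitian from G.isSymm_adjMatrix ..).eigenvalues i

end SimpleGraph

/-! The links in the complex of independent sets expand so well that the down-up walk has spectral
gap at least `1 / k ^ 2`. Write `n`, `Δ`, `λ` for the order, maximum degree and least eigenvalue of
`G`. The link of an independent set `S` with `k - 2` elements is the complement of `G` on the
vertices extending `S`. On functions of mean zero its adjacency form is at most `-1 - λ` times the
squared norm, while its degrees are at least `n - (k - 1) * (Δ + 1)`; the hypothesis makes the ratio
at most `1 / k` (`isExpander_linkEdge_of_card`). Since `γ / (1 - γ) = 1 / (c + 2)` for `γ = 1 / (c +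
3)`, trickling down (`IsExpander.trickle_down`) gives expansion `1 / (c + 2)` for the link of every
face with `c ≤ k - 2` elements; connectivity comes from counting common non-neighbours.

For a function on the top faces let `E c` be the normalized energy of its conditional expectation on
the faces with `c` elements. Averaging from edges to vertices contracts variance in each link
(`IsExpander.variance_contraction`); summed over links this reads `(c + 1) * (E (c + 1) - E c) ≤ (c
+ 3) * (E (c + 2) - E (c + 1))`. By induction `E k - E 0 ≤ k ^ 2 * (E k - E (k - 1))`, which is the
Poincaré inequality `levelEnergy_pred_le`.

The walk is symmetric and positive semidefinite, so its `ℓ₁` distance to uniform after `t` steps is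
at most `√(N - 1) * (1 - 1 / k ^ 2) ^ t`, where `N ≤ n ^ k` counts the states. Time `B` allows for
`n ^ k` instead of its square root; for `k ≥ 2` this slack pays for rounding `B` down. For `k = 1` a
single step is exactly uniform, and small cases are checked directly. -/

/-! ### Quadratic forms of symmetric matrices -/

namespace Matrix

variable {V : Type*} [Fintype V] [DecidableEq V]

/-- A bound on all eigenvalues of a real symmetric matrix bounds its quadratic form. -/
theorem IsHermitian.quadratic_le_of_eigenvalue_le {A : Matrix V V ℝ} (hA : A.IsHermitian) {c : ℝ}
    (h : ∀ (μ : ℝ) (v : V → ℝ), v ≠ 0 → A *ᵥ v = μ • v → μ ≤ c) (x : V → ℝ) :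
    x ⬝ᵥ (A *ᵥ x) ≤ c * (x ⬝ᵥ x) := by
  have hB : (c • (1 : Matrix V V ℝ) - A).IsHermitian :=
    (isHermitian_one.smul (by simp [IsSelfAdjoint])).sub hA
  have hpsd : (c • (1 : Matrix V V ℝ) - A).PosSemidef := by
    rw [hB.posSemidef_iff_eigenvalues_nonneg]
    intro i
    have hv := hB.mulVec_eigenvectorBasis i
    have hne : (hB.eigenvectorBasis i).ofLp ≠ 0 := by
      intro h0
      have := hB.eigenvectorBasis.orthonormal.ne_zero i
      exact this (by ext j; simpa using congrFun h0 j)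
    have := h (c - hB.eigenvalues i) _ hne (by
      rw [sub_smul, ← hv, sub_mulVec, smul_mulVec, one_mulVec]
      abel)
    simp only [Pi.zero_apply]
    linarith
  have := hpsd.dotProduct_mulVec_nonneg x
  simp only [star_trivial, sub_mulVec, smul_mulVec, one_mulVec, dotProduct_sub,
    dotProduct_smul, smul_eq_mul] at this
  linarith

end Matrix

/-! ### Expanders and trickling down -/

/-- The weighted graph `w` has expansion `γ`: the quadratic form of its random walk is at most `γ`
on functions of mean zero. -/
def IsExpander {V : Type*} [Fintype V] (w : V → V → ℝ) (γ : ℝ) : Prop :=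
  ∀ f : V → ℝ, ∑ x, (∑ y, w x y) * f x = 0 →
    ∑ x, ∑ y, w x y * f x * f y ≤ γ * ∑ x, (∑ y, w x y) * f x ^ 2

namespace IsExpander

variable {V : Type*} [Fintype V]

theorem sum_edges_sub_const {w : V → V → ℝ} (hs : ∀ x y, w x y = w y x) (f : V → ℝ) (m : ℝ) :
    ∑ x, ∑ y, w x y * (f x - m) * (f y - m) = ∑ x, ∑ y, w x y * f x * f y -
      2 * m * ∑ x, (∑ y, w x y) * f x + m ^ 2 * ∑ x, ∑ y, w x y := by
  have h1 : ∑ x, ∑ y, w x y * f x = ∑ x, (∑ y, w x y) * f x := by simp [sum_mul]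
  have h2 : ∑ x, ∑ y, w x y * f y = ∑ x, (∑ y, w x y) * f x := by
    rw [sum_comm, ← h1]
    exact sum_congr rfl fun x _ => sum_congr rfl fun y _ => by rw [hs]
  calc _ = ∑ x, ∑ y, (w x y * f x * f y - m * (w x y * f x) - m * (w x y * f y) +
        m ^ 2 * w x y) := sum_congr rfl fun x _ => sum_congr rfl fun y _ => by ring
    _ = _ := by
      simp only [sum_add_distrib, sum_sub_distrib, ← mul_sum, h1, h2]; ring

theorem sum_vertices_sub_const (d f : V → ℝ) (m : ℝ) :
    ∑ x, d x * (f x - m) ^ 2 =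
      ∑ x, d x * f x ^ 2 - 2 * m * ∑ x, d x * f x + m ^ 2 * ∑ x, d x := by
  calc _ = ∑ x, (d x * f x ^ 2 - 2 * m * (d x * f x) + m ^ 2 * d x) :=
        sum_congr rfl fun x _ => by ring
    _ = _ := by
      simp only [sum_add_distrib, sum_sub_distrib, ← mul_sum]

/-- Any centring may replace the degree-weighted mean: moving from `m` to the true mean changes the
inequality by `(1 - γ) * m ^ 2` times the total weight, in the favourable direction. -/
theorem of_forall_exists_sub_const {w : V → V → ℝ} {γ : ℝ} (hγ : γ ≤ 1) (hw : ∀ x y, 0 ≤ w x y)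
    (hs : ∀ x y, w x y = w y x)
    (h : ∀ f : V → ℝ, ∃ m : ℝ, ∑ x, ∑ y, w x y * (f x - m) * (f y - m) ≤
      γ * ∑ x, (∑ y, w x y) * (f x - m) ^ 2) : IsExpander w γ := by
  intro f hf
  obtain ⟨m, hm⟩ := h f
  rw [sum_edges_sub_const hs, sum_vertices_sub_const, hf] at hm
  have : 0 ≤ (1 - γ) * (m ^ 2 * ∑ x, ∑ y, w x y) :=
    mul_nonneg (by linarith) (mul_nonneg (sq_nonneg m)
      (sum_nonneg fun x _ => sum_nonneg fun y _ => hw x y))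
  linarith

/-- Form for arbitrary `f`: apply expansion after subtracting the weighted mean, on whose constant
part the walk acts as the identity. -/
theorem sum_le {w : V → V → ℝ} {γ : ℝ} (h : IsExpander w γ) (hw : ∀ x y, 0 ≤ w x y)
    (hs : ∀ x y, w x y = w y x) (f : V → ℝ) :
    ∑ x, ∑ y, w x y * f x * f y ≤ γ * ∑ x, (∑ y, w x y) * f x ^ 2 +
      (1 - γ) * ((∑ x, (∑ y, w x y) * f x) ^ 2 / ∑ x, ∑ y, w x y) := by
  set d : V → ℝ := fun x => ∑ y, w x y with hd
  set D : ℝ := ∑ x, d x with hD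
  set M : ℝ := ∑ x, d x * f x with hM
  by_cases hD0 : D = 0
  · have hd0 : ∀ x, d x = 0 := fun x =>
      (sum_eq_zero_iff_of_nonneg fun x _ => sum_nonneg fun y _ => hw x y).1 hD0 x (mem_univ x)
    have hw0 : ∀ x y, w x y = 0 := fun x y =>
      (sum_eq_zero_iff_of_nonneg fun y _ => hw x y).1 (hd0 x) y (mem_univ y)
    simp [hw0, hM, hd0]
  · have h0 : ∑ x, (∑ y, w x y) * (f x - M / D) = 0 := by
      calc _ = ∑ x, (d x * f x - M / D * d x) := sum_congr rfl fun x _ => by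
            simp only [hd]; ring
        _ = M - M / D * D := by rw [sum_sub_distrib, ← mul_sum]
        _ = 0 := by rw [div_mul_cancel₀ _ hD0, sub_self]
    have := h _ h0
    rw [sum_edges_sub_const hs, sum_vertices_sub_const] at this
    change _ - 2 * (M / D) * M + (M / D) ^ 2 * D ≤
      γ * (∑ x, d x * f x ^ 2 - 2 * (M / D) * M + (M / D) ^ 2 * D) at this
    have e : M ^ 2 / D = (M / D) ^ 2 * D := by field_simp
    change _ ≤ γ * ∑ x, d x * f x ^ 2 + (1 - γ) * (M ^ 2 / D)
    rw [e]
    have e2 : M / D * M = (M / D) ^ 2 * D := by field_simp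
    rw [mul_assoc 2, e2] at this
    linarith

variable [DecidableEq V]

theorem of_eigenvalue_le {w : V → V → ℝ} {c : ℝ} (hc : 0 ≤ c) (hw : ∀ x y, 0 ≤ w x y)
    (hs : ∀ x y, w x y = w y x)
    (h : ∀ (μ : ℝ) (f : V → ℝ), (∀ x, ∑ y, w x y * f y = μ * (∑ y, w x y) * f x) →
      ∑ x, (∑ y, w x y) * f x = 0 → 0 < ∑ x, (∑ y, w x y) * f x ^ 2 → μ ≤ c) :
    IsExpander w c := by
  set d : V → ℝ := fun x => ∑ y, w x y with hd
  have hd0 : ∀ x, 0 ≤ d x := fun x => sum_nonneg fun y _ => hw x y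
  have hw0 : ∀ x y, d x = 0 → w x y = 0 := fun x y hx =>
    (sum_eq_zero_iff_of_nonneg fun y _ => hw x y).1 hx y (mem_univ y)
  have hw0' : ∀ x y, d y = 0 → w x y = 0 := fun x y hy => by rw [hs]; exact hw0 y x hy
  set D : ℝ := ∑ x, d x with hD
  set u : V → ℝ := fun x => √(d x) with hu
  have huu : ∀ x, u x * u x = d x := fun x => Real.mul_self_sqrt (hd0 x)
  have hu0 : ∀ x, u x = 0 ↔ d x = 0 := fun x => Real.sqrt_eq_zero (hd0 x)
  -- Normalized adjacency matrix minus the projection onto its eigenvector `u` of eigenvalue `1`, so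
  -- that `A` annihilates `u`.
  set A : Matrix V V ℝ := Matrix.of fun x y => w x y / (u x * u y) - u x * u y / D with hA
  have hAh : A.IsHermitian := by
    ext x y
    simp [hA, hs x y, mul_comm]
  have hwu : ∀ x y, w x y / (u x * u y) * (u x * u y) = w x y := by
    intro x y
    by_cases hx : d x = 0
    · simp [hw0 x y hx]
    by_cases hy : d y = 0
    · simp [hw0' x y hy]
    have : u x ≠ 0 := fun h' => hx ((hu0 x).1 h')
    have : u y ≠ 0 := fun h' => hy ((hu0 y).1 h')
    field_simp
  have hwu' : ∀ x y, w x y / (u x * u y) * u y = w x y / u x := by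
    intro x y
    by_cases hy : d y = 0
    · simp [hw0' x y hy]
    have : u y ≠ 0 := fun h' => hy ((hu0 y).1 h')
    rw [div_mul_eq_div_div, div_mul_cancel₀ _ this]
  have hwu2 : ∀ x y, w x y / (u x * u y) * u x = w x y / u y := by
    intro x y
    have := hwu' y x
    rw [hs y x, mul_comm (u y)] at this
    exact this
  have hquad := hAh.quadratic_le_of_eigenvalue_le (c := c) ?_
  · intro f hf
    have := hquad fun x => u x * f x
    have e1 : (fun x => u x * f x) ⬝ᵥ (A.mulVec fun x => u x * f x) =
        ∑ x, ∑ y, w x y * f x * f y := by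
      calc _ = ∑ x, ∑ y, (w x y * f x * f y - (d x * f x) * (d y * f y) / D) := by
            simp only [dotProduct, Matrix.mulVec, mul_sum, hA, Matrix.of_apply]
            refine sum_congr rfl fun x _ => sum_congr rfl fun y _ => ?_
            rw [← huu x, ← huu y]
            linear_combination f x * f y * hwu x y
        _ = _ := by
            simp only [sum_sub_distrib, ← sum_div, ← mul_sum]
            rw [hf]; simp
    have e2 : (fun x => u x * f x) ⬝ᵥ (fun x => u x * f x) = ∑ x, d x * f x ^ 2 :=
      sum_congr rfl fun x _ => by rw [← huu]; ring
    rwa [e1, e2] at this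
  · intro μ v hv hμ
    by_contra! hlt
    -- A nonzero eigenvalue makes `v` vanish at isolated vertices and be orthogonal to `u`; then `v
    -- / u` is an eigenfunction of the walk with mean zero.
    have hμ0 : μ ≠ 0 := (hc.trans_lt hlt).ne'
    have hrow : ∀ x, ∑ y, (w x y / (u x * u y) - u x * u y / D) * v y = μ * v x := fun x =>
      congrFun hμ x
    have hv0 : ∀ x, d x = 0 → v x = 0 := by
      intro x hx
      have := hrow x
      rw [sum_eq_zero fun y _ => by rw [hw0 x y hx, (hu0 x).2 hx]; simp] at this
      simpa [hμ0] using this.symm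
    have hDu : D ≠ 0 := by
      intro h0
      have : ∀ x, d x = 0 := fun x =>
        (sum_eq_zero_iff_of_nonneg fun x _ => hd0 x).1 h0 x (mem_univ x)
      exact hv (funext fun x => hv0 x (this x))
    have horth : ∑ x, u x * v x = 0 := by
      have h1 : ∑ x, u x * (μ * v x) = 0 := by
        calc _ = ∑ x, ∑ y, u x * ((w x y / (u x * u y) - u x * u y / D) * v y) :=
              sum_congr rfl fun x _ => by rw [← hrow, mul_sum]
          _ = ∑ y, (∑ x, (w y x / u y - d x * u y / D)) * v y := by
              rw [sum_comm]
              refine sum_congr rfl fun y _ => ?_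
              rw [sum_mul]
              refine sum_congr rfl fun x _ => ?_
              rw [hs y x, ← hwu2 x y, ← huu x]; ring
          _ = 0 := by
              refine sum_eq_zero fun y _ => ?_
              rw [sum_sub_distrib, ← sum_div, ← sum_div, ← sum_mul]
              change (d y / u y - D * u y / D) * v y = 0
              rw [← huu y, mul_div_cancel_left₀ _ hDu]
              by_cases hy : u y = 0
              · simp [hy]
              · field_simp; ring
      have h2 : μ * ∑ x, u x * v x = 0 := by
        rw [mul_sum, ← h1]; exact sum_congr rfl fun x _ => by ring
      exact (mul_eq_zero.1 h2).resolve_left hμ0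
    have hvu : ∀ x, u x * (v x / u x) = v x := by
      intro x
      by_cases hx : d x = 0
      · simp [hv0 x hx]
      · exact mul_div_cancel₀ _ fun h' => hx ((hu0 x).1 h')
    refine hlt.not_ge (h μ (fun x => v x / u x) ?_ ?_ ?_)
    · intro x
      have h3 : ∑ y, w x y / (u x * u y) * v y = μ * v x := by
        rw [← hrow x]
        simp only [sub_mul, sum_sub_distrib]
        have : ∑ y, u x * u y / D * v y = u x / D * ∑ y, u y * v y := by
          rw [mul_sum]; exact sum_congr rfl fun y _ => by ring
        rw [this, horth]; ring
      calc ∑ y, w x y * (v y / u y) = u x * ∑ y, w x y / (u x * u y) * v y := by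
            rw [mul_sum]
            refine sum_congr rfl fun y _ => ?_
            rw [← mul_assoc, mul_comm (u x), hwu2]; ring
        _ = μ * (u x * u x) * (v x / u x) := by
            rw [h3]; nth_rewrite 1 [← hvu x]; ring
        _ = _ := by rw [huu]
    · rw [← horth]
      refine sum_congr rfl fun x _ => ?_
      change d x * _ = _
      rw [← huu x, mul_assoc, hvu]
    · have : ∑ x, d x * (v x / u x) ^ 2 = ∑ x, v x ^ 2 := by
        refine sum_congr rfl fun x _ => ?_
        rw [← huu x]; nth_rewrite 2 [← hvu x]; ring
      change 0 < ∑ x, d x * (v x / u x) ^ 2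
      rw [this]
      obtain ⟨x, hx⟩ := Function.ne_iff.1 hv
      exact sum_pos' (fun x _ => sq_nonneg _) ⟨x, mem_univ x, by
        have : v x ≠ 0 := hx
        positivity⟩

/-- The trickling-down theorem: expansion of the links of the vertices of a connected
two-dimensional complex gives expansion of its weighted graph. -/
theorem trickle_down {t : V → V → V → ℝ} {w : V → V → ℝ} {γ : ℝ} (hγ0 : 0 ≤ γ) (hγ : γ ≤ 1 / 2)
    (ht : ∀ x y z, 0 ≤ t x y z) (h12 : ∀ x y z, t x y z = t y x z)
    (h23 : ∀ x y z, t x y z = t x z y) (hw : ∀ x y, w x y = ∑ z, t x y z)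
    (hlink : ∀ z, IsExpander (t z) γ)
    (hconn : ∀ x y, 0 < ∑ z, w x z → 0 < ∑ z, w y z → x ≠ y → 0 < w x y ∨
      ∃ z, 0 < w x z ∧ 0 < w z y) :
    IsExpander w (γ / (1 - γ)) := by
  have hw0 : ∀ x y, 0 ≤ w x y := fun x y => by rw [hw]; exact sum_nonneg fun z _ => ht x y z
  have hs : ∀ x y, w x y = w y x := fun x y => by
    rw [hw, hw]; exact sum_congr rfl fun z _ => h12 x y z
  have hγ1 : 0 < 1 - γ := by linarith
  refine of_eigenvalue_le (div_nonneg hγ0 hγ1.le) hw0 hs fun μ f hμ hf hX => ?_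
  set d : V → ℝ := fun x => ∑ y, w x y with hd
  have hd0 : ∀ x, 0 ≤ d x := fun x => sum_nonneg fun y _ => hw0 x y
  set X : ℝ := ∑ x, d x * f x ^ 2 with hXd
  have hform : ∑ x, ∑ y, w x y * f x * f y = μ * X := by
    rw [hXd, mul_sum]
    refine sum_congr rfl fun x _ => ?_
    calc _ = f x * ∑ y, w x y * f y := by
          rw [mul_sum]; exact sum_congr rfl fun y _ => by ring
      _ = _ := by rw [hμ]; ring
  have hrowt : ∀ z x, ∑ y, t z x y = w z x := fun z x => (hw z x).symm
  -- Sum of `sum_le` over the links of all `z`. By the eigenvalue equation the mean of `f` over the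
  -- link of `z` is `μ * f z`, whence the term in `μ ^ 2`.
  have hquad : μ * X ≤ γ * X + (1 - γ) * (μ ^ 2 * X) := by
    have h1 : ∀ z, ∑ x, ∑ y, t z x y * f x * f y ≤ γ * ∑ x, w z x * f x ^ 2 +
        (1 - γ) * (μ ^ 2 * (d z * f z ^ 2)) := by
      intro z
      have := (hlink z).sum_le (ht z) (h23 z) f
      simp only [hrowt] at this
      rw [hμ z] at this
      refine this.trans_eq ?_
      congr 2
      change (μ * d z * f z) ^ 2 / d z = _
      by_cases hz : d z = 0
      · simp [hz]
      · field_simp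
    have h2 := sum_le_sum fun z (_ : z ∈ univ) => h1 z
    have e1 : ∑ z, ∑ x, ∑ y, t z x y * f x * f y = μ * X := by
      rw [← hform, sum_comm]
      refine sum_congr rfl fun x _ => ?_
      rw [sum_comm]
      refine sum_congr rfl fun y _ => ?_
      rw [hw, sum_mul, sum_mul]
      exact sum_congr rfl fun z _ => by rw [h12 z, h23 x]
    have e2 : ∑ z, ∑ x, w z x * f x ^ 2 = X := by
      rw [sum_comm]
      refine sum_congr rfl fun x _ => ?_
      rw [← sum_mul]
      congr 1
      exact sum_congr rfl fun z _ => hs z x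
    rw [e1, sum_add_distrib, ← mul_sum, ← mul_sum, ← mul_sum, e2] at h2
    exact h2
  -- If `μ ≥ 1`, the Dirichlet form `2 * (1 - μ) * X` must vanish, so `f` is constant on the
  -- non-isolated vertices by connectivity, and mean zero contradicts `0 < X`.
  have hμ1 : μ < 1 := by
    by_contra! hge
    have hdir : ∑ x, ∑ y, w x y * (f x - f y) ^ 2 = 2 * (1 - μ) * X := by
      have e2 : ∑ x, ∑ y, w x y * f x ^ 2 = X := by simp only [hXd, hd, sum_mul]
      have e3 : ∑ x, ∑ y, w x y * f y ^ 2 = X := by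
        rw [sum_comm, ← e2]
        exact sum_congr rfl fun x _ => sum_congr rfl fun y _ => by rw [hs]
      calc _ = ∑ x, ∑ y, (w x y * f x ^ 2 + w x y * f y ^ 2 - 2 * (w x y * f x * f y)) :=
            sum_congr rfl fun x _ => sum_congr rfl fun y _ => by ring
        _ = _ := by
            simp only [sum_add_distrib, sum_sub_distrib, ← mul_sum, e2, e3, hform]; ring
    have hterm : ∀ x y, 0 ≤ w x y * (f x - f y) ^ 2 := fun x y =>
      mul_nonneg (hw0 x y) (sq_nonneg _)
    have hzero : ∑ x, ∑ y, w x y * (f x - f y) ^ 2 = 0 :=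
      le_antisymm (by rw [hdir]; nlinarith)
        (sum_nonneg fun x _ => sum_nonneg fun y _ => hterm x y)
    have heq : ∀ x y, 0 < w x y → f x = f y := by
      intro x y hxy
      have h1 := (sum_eq_zero_iff_of_nonneg fun x _ => sum_nonneg fun y _ => hterm x y).1 hzero
        x (mem_univ x)
      have h2 := (sum_eq_zero_iff_of_nonneg fun y _ => hterm x y).1 h1 y (mem_univ y)
      have h3 := (mul_eq_zero.1 h2).resolve_left hxy.ne'
      nlinarith [pow_eq_zero_iff (two_ne_zero) |>.1 h3]
    have hconst : ∀ x y, 0 < d x → 0 < d y → f x = f y := by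
      intro x y hx hy
      by_cases hxy : x = y
      · rw [hxy]
      · rcases hconn x y hx hy hxy with h | ⟨z, h1, h2⟩
        · exact heq x y h
        · exact (heq x z h1).trans (heq z y h2)
    obtain ⟨a, -, ha⟩ := exists_ne_zero_of_sum_ne_zero hX.ne'
    have hda : 0 < d a := (hd0 a).lt_of_ne' (left_ne_zero_of_mul ha)
    have hall : ∀ x, d x * f x = d x * f a := by
      intro x
      rcases (hd0 x).eq_or_lt with h | h
      · rw [← h]; simp
      · rw [hconst x a h hda]
    have h5 : (∑ x, d x) * f a = 0 := by
      rw [sum_mul, ← hf]; exact sum_congr rfl fun x _ => (hall x).symm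
    have h6 : 0 < ∑ x, d x := sum_pos' (fun x _ => hd0 x) ⟨a, mem_univ a, hda⟩
    have h7 : f a = 0 := (mul_eq_zero.1 h5).resolve_left h6.ne'
    exact ha (by simp [h7])
  rw [le_div_iff₀ hγ1]
  -- Factorization of `hquad`: `γ - μ + (1 - γ) * μ ^ 2 = (1 - μ) * (γ - (1 - γ) * μ)`.
  have h8 : 0 ≤ (1 - μ) * (γ - (1 - γ) * μ) * X := by nlinarith
  have h9 : 0 ≤ (1 - μ) * (γ - (1 - γ) * μ) := nonneg_of_mul_nonneg_left h8 hX
  have h10 : 0 ≤ γ - (1 - γ) * μ := nonneg_of_mul_nonneg_right h9 (by linarith)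
  linarith

end IsExpander

/-! ### Sums over faces and over links -/

section FaceSums

variable {V : Type*} [DecidableEq V]

/-- The sum of `f` over the members of `F` that contain `S`. -/
def faceSum (F : Finset (Finset V)) (f : Finset V → ℝ) (S : Finset V) : ℝ :=
  ∑ T ∈ F with S ⊆ T, f T

/-- The function induced by `g` on the vertices of the link of `S`. -/
def linkVertex (g : Finset V → ℝ) (S : Finset V) (x : V) : ℝ :=
  if x ∈ S then 0 else g (insert x S)

/-- The function induced by `g` on the edges of the link of `S`. -/
def linkEdge (g : Finset V → ℝ) (S : Finset V) (x y : V) : ℝ :=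
  if x ∈ S then 0 else linkVertex g (insert x S) y

theorem linkEdge_comm (g : Finset V → ℝ) (S : Finset V) (x y : V) :
    linkEdge g S x y = linkEdge g S y x := by
  unfold linkEdge linkVertex
  by_cases hx : x ∈ S <;> by_cases hy : y ∈ S <;> by_cases hxy : x = y <;>
    simp_all [insert_comm, eq_comm]

theorem linkVertex_nonneg {g : Finset V → ℝ} (hg : ∀ S, 0 ≤ g S) (S : Finset V) (x : V) :
    0 ≤ linkVertex g S x := by
  unfold linkVertex; split_ifs <;> simp [hg]

theorem linkEdge_nonneg {g : Finset V → ℝ} (hg : ∀ S, 0 ≤ g S) (S : Finset V) (x y : V) :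
    0 ≤ linkEdge g S x y := by
  unfold linkEdge; split_ifs <;> simp [linkVertex_nonneg hg]

theorem linkEdge_eq_of_mem {g : Finset V → ℝ} {S : Finset V} {x y : V} (hx : x ∉ S) (hy : y ∉ S)
    (hxy : x ≠ y) : linkEdge g S x y = g (insert y (insert x S)) := by
  simp [linkEdge, linkVertex, hx, hy, hxy.symm]

variable [Fintype V]

/-- Double counting: each `T ⊇ S` in `F` appears once for every one of the `k - S.card` vertices of
`T \ S`. -/
theorem sum_linkVertex_faceSum {F : Finset (Finset V)} {k : ℕ} (hF : ∀ T ∈ F, T.card = k)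
    (f : Finset V → ℝ) (S : Finset V) :
    ∑ x, linkVertex (faceSum F f) S x = ((k : ℝ) - S.card) * faceSum F f S := by
  have h1 : ∀ x, linkVertex (faceSum F f) S x =
      ∑ T ∈ F, if S ⊆ T then (if x ∈ T \ S then f T else 0) else 0 := by
    intro x
    unfold linkVertex faceSum
    split_ifs with hx
    · exact (sum_eq_zero fun T _ => by simp [hx]).symm
    · rw [sum_filter]
      refine sum_congr rfl fun T _ => ?_
      by_cases h : S ⊆ T <;> by_cases h' : x ∈ T <;> simp [insert_subset_iff, h, h', hx]
  simp only [h1]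
  rw [sum_comm, faceSum, mul_sum, sum_filter]
  refine sum_congr rfl fun T hT => ?_
  split_ifs with h
  · rw [sum_ite_mem, univ_inter, sum_const, nsmul_eq_mul, card_sdiff_of_subset h,
      Nat.cast_sub (card_le_card h), hF T hT]
  · simp

theorem sum_linkEdge_faceSum {F : Finset (Finset V)} {k : ℕ} (hF : ∀ T ∈ F, T.card = k)
    (f : Finset V → ℝ) (S : Finset V) (x : V) :
    ∑ y, linkEdge (faceSum F f) S x y =
      ((k : ℝ) - S.card - 1) * linkVertex (faceSum F f) S x := by
  unfold linkEdge
  by_cases hx : x ∈ S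
  · simp [hx, linkVertex]
  · simp only [hx, if_false]
    rw [sum_linkVertex_faceSum hF, card_insert_of_notMem hx]
    simp only [linkVertex, hx, if_false]
    push_cast; ring

/-- Each set with `c + 1` elements arises from `c + 1` pairs of a set and an added vertex. -/
theorem sum_powersetCard_linkVertex (g : Finset V → ℝ) (c : ℕ) :
    ∑ S ∈ powersetCard c (univ : Finset V), ∑ x, linkVertex g S x =
      ((c : ℝ) + 1) * ∑ S ∈ powersetCard (c + 1) (univ : Finset V), g S := by
  have h2 : ((c : ℝ) + 1) * ∑ S ∈ powersetCard (c + 1) (univ : Finset V), g S =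
      ∑ T ∈ powersetCard (c + 1) (univ : Finset V), ∑ _x ∈ T, g T := by
    rw [mul_sum]
    refine sum_congr rfl fun T hT => ?_
    rw [sum_const, (mem_powersetCard.1 hT).2, nsmul_eq_mul]; push_cast; rfl
  have h1 : ∀ S : Finset V, ∑ x, linkVertex g S x = ∑ x ∈ univ \ S, g (insert x S) := by
    intro S
    rw [← filter_notMem_eq_sdiff, sum_filter]
    exact sum_congr rfl fun x _ => by by_cases hx : x ∈ S <;> simp [linkVertex, hx]
  rw [h2]
  simp only [h1]
  rw [sum_sigma', sum_sigma']
  refine sum_bij' (fun p _ => ⟨insert p.2 p.1, p.2⟩) (fun p _ => ⟨p.1.erase p.2, p.2⟩)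
    ?_ ?_ ?_ ?_ ?_
  · rintro ⟨S, x⟩ h
    simp only [mem_sigma, mem_powersetCard, subset_univ, true_and, mem_sdiff, mem_univ] at h ⊢
    exact ⟨by rw [card_insert_of_notMem h.2, h.1], mem_insert_self _ _⟩
  · rintro ⟨S, x⟩ h
    simp only [mem_sigma, mem_powersetCard, subset_univ, true_and, mem_sdiff, mem_univ] at h ⊢
    exact ⟨by rw [card_erase_of_mem h.2, h.1]; rfl, notMem_erase _ _⟩
  · rintro ⟨S, x⟩ h
    simp only [mem_sigma, mem_sdiff] at h
    simp [erase_insert h.2.2]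
  · rintro ⟨S, x⟩ h
    simp only [mem_sigma] at h
    simp [insert_erase h.2]
  · rintro ⟨S, x⟩ h; rfl

theorem sum_powersetCard_linkEdge (g : Finset V → ℝ) (c : ℕ) :
    ∑ S ∈ powersetCard c (univ : Finset V), ∑ x, ∑ y, linkEdge g S x y =
      ((c : ℝ) + 1) * (((c : ℝ) + 2) *
        ∑ S ∈ powersetCard (c + 2) (univ : Finset V), g S) := by
  have h := sum_powersetCard_linkVertex (fun S => ∑ y, linkVertex g S y) c
  rw [sum_powersetCard_linkVertex g (c + 1)] at h
  push_cast at h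
  rw [show (c : ℝ) + 1 + 1 = c + 2 by ring] at h
  rw [← h]
  refine sum_congr rfl fun S _ => sum_congr rfl fun x _ => ?_
  unfold linkEdge
  by_cases hx : x ∈ S <;> simp [hx, linkVertex]

end FaceSums

/-! ### Variance contraction from edges to vertices -/

namespace IsExpander

variable {V : Type*} [Fintype V]

/-- In a weighted graph of expansion `γ`, averaging a function on the edges to the vertices
contracts its variance by `(1 + γ) / 2`. -/
theorem variance_contraction {w a : V → V → ℝ} {γ : ℝ} (h : IsExpander w γ) (hγ : 0 ≤ γ)
    (hw : ∀ x y, 0 ≤ w x y) (hs : ∀ x y, w x y = w y x) (has : ∀ x y, a x y = a y x)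
    (haw : ∀ x y, w x y = 0 → a x y = 0) :
    ∑ x, (∑ y, a x y) ^ 2 / (∑ y, w x y) - (∑ x, ∑ y, a x y) ^ 2 / (∑ x, ∑ y, w x y) ≤
      (1 + γ) / 2 * (∑ x, ∑ y, a x y ^ 2 / w x y -
        (∑ x, ∑ y, a x y) ^ 2 / (∑ x, ∑ y, w x y)) := by
  set d : V → ℝ := fun x => ∑ y, w x y with hd
  set D : ℝ := ∑ x, d x with hD
  set b : V → ℝ := fun x => ∑ y, a x y with hb
  set M : ℝ := ∑ x, b x with hM
  have hd0 : ∀ x, 0 ≤ d x := fun x => sum_nonneg fun y _ => hw x y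
  have hbd : ∀ x, d x = 0 → b x = 0 := fun x hx => sum_eq_zero fun y _ =>
    haw x y ((sum_eq_zero_iff_of_nonneg fun y _ => hw x y).1 hx y (mem_univ y))
  have hMD : D = 0 → M = 0 := fun h0 => sum_eq_zero fun x _ =>
    hbd x ((sum_eq_zero_iff_of_nonneg fun x _ => hd0 x).1 h0 x (mem_univ x))
  set r : ℝ := M / D with hr
  have hrD : r * D = M := by
    by_cases h0 : D = 0
    · rw [h0, hMD h0, mul_zero]
    · rw [hr]; field_simp
  have hrM : M ^ 2 / D = r * M := by rw [hr]; ring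
  -- The edge function is `a / w`; `F` is its average at a vertex, centred at the global mean `r`.
  -- Where weights vanish so do `a` and `b`, so division by zero is harmless.
  set F : V → ℝ := fun x => b x / d x - r with hF
  have hdF : ∀ x, d x * F x = b x - r * d x := by
    intro x
    by_cases h0 : d x = 0
    · simp [h0, hbd x h0]
    · simp only [hF]; field_simp
  have hmean : ∑ x, d x * F x = 0 := by
    simp only [hdF, sum_sub_distrib, ← mul_sum]
    change M - r * D = 0
    rw [hrD, sub_self]
  set B : ℝ := ∑ x, d x * F x ^ 2 with hB
  have hBeq : B = ∑ x, b x ^ 2 / d x - M ^ 2 / D := by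
    have : ∀ x, d x * F x ^ 2 = b x ^ 2 / d x - 2 * r * b x + r ^ 2 * d x := by
      intro x
      by_cases h0 : d x = 0
      · simp [h0, hbd x h0]
      · simp only [hF]; field_simp; ring
    rw [hB, hrM]
    simp only [this, sum_add_distrib, sum_sub_distrib, ← mul_sum]
    change _ - 2 * r * M + r ^ 2 * D = _
    linear_combination r * hrD
  have hA : ∑ x, ∑ y, (a x y - r * w x y) ^ 2 / w x y =
      ∑ x, ∑ y, a x y ^ 2 / w x y - M ^ 2 / D := by
    have : ∀ x y, (a x y - r * w x y) ^ 2 / w x y =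
        a x y ^ 2 / w x y - 2 * r * a x y + r ^ 2 * w x y := by
      intro x y
      by_cases h0 : w x y = 0
      · simp [h0, haw x y h0]
      · field_simp; ring
    rw [hrM]
    simp only [this, sum_add_distrib, sum_sub_distrib, ← mul_sum]
    change _ - 2 * r * M + r ^ 2 * D = _
    linear_combination r * hrD
  have hexp : ∑ x, ∑ y, w x y * F x * F y ≤ γ * B := h F hmean
  have hg : 0 < 1 + γ := by linarith
  -- Weighted AM-GM. The left side sums to `2 * B`, and the constant `1 / (2 * (1 + γ))` makes the
  -- last term sum to at most `B` by expansion, leaving one `B` to bound.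
  have hpt : ∀ x y, (a x y - r * w x y) * (F x + F y) ≤
      (1 + γ) / 2 * ((a x y - r * w x y) ^ 2 / w x y) +
        1 / (2 * (1 + γ)) * (w x y * (F x + F y) ^ 2) := by
    intro x y
    rcases (hw x y).eq_or_lt with h0 | h0
    · simp [haw x y h0.symm, ← h0]
    · have : 0 ≤ ((1 + γ) * (a x y - r * w x y) - w x y * (F x + F y)) ^ 2 /
        (2 * (1 + γ) * w x y) := by positivity
      refine sub_nonneg.1 (this.trans_eq ?_)
      field_simp
      ring
  have hsum := sum_le_sum fun x (_ : x ∈ univ) => sum_le_sum fun y (_ : y ∈ univ) => hpt x y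
  have hx1 : ∑ x, ∑ y, (a x y - r * w x y) * F x = B := by
    rw [hB]
    refine sum_congr rfl fun x _ => ?_
    rw [← sum_mul, sum_sub_distrib, ← mul_sum]
    change (b x - r * d x) * F x = _
    rw [← hdF]; ring
  have hx2 : ∑ x, ∑ y, (a x y - r * w x y) * F y = B := by
    rw [sum_comm, ← hx1]
    exact sum_congr rfl fun x _ => sum_congr rfl fun y _ => by rw [has, hs]
  have hx3 : ∑ x, ∑ y, w x y * F x ^ 2 = B := by simp only [hB, hd, sum_mul]
  have hx4 : ∑ x, ∑ y, w x y * F y ^ 2 = B := by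
    rw [sum_comm, ← hx3]
    exact sum_congr rfl fun x _ => sum_congr rfl fun y _ => by rw [hs]
  have hsq : ∑ x, ∑ y, w x y * (F x + F y) ^ 2 = 2 * B + 2 * ∑ x, ∑ y, w x y * F x * F y := by
    calc _ = ∑ x, ∑ y, (w x y * F x ^ 2 + w x y * F y ^ 2 + 2 * (w x y * F x * F y)) :=
          sum_congr rfl fun x _ => sum_congr rfl fun y _ => by ring
      _ = _ := by
          simp only [sum_add_distrib, ← mul_sum, hx3, hx4]; ring
  obtain ⟨e, he⟩ : ∃ e, e = 1 / (2 * (1 + γ)) := ⟨_, rfl⟩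
  rw [← he] at hsum
  simp only [mul_add (_ - _), sum_add_distrib, ← mul_sum, hx1, hx2, hA] at hsum
  rw [hsq, he] at hsum
  change ∑ x, b x ^ 2 / d x - M ^ 2 / D ≤ _
  rw [← hBeq]
  have hlast : 1 / (2 * (1 + γ)) * (2 * B + 2 * ∑ x, ∑ y, w x y * F x * F y) ≤ B := by
    calc _ ≤ 1 / (2 * (1 + γ)) * (2 * B + 2 * (γ * B)) := by gcongr
      _ = B := by field_simp
  linarith

end IsExpander

/-! ### Expansion of the links of independent sets -/

namespace SimpleGraph

variable {V : Type*} [Fintype V] [DecidableEq V] (G : SimpleGraph V) [DecidableRel G.Adj]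

theorem lambdaMin_mul_sum_sq_le (f : V → ℝ) :
    G.lambdaMin * ∑ x, f x ^ 2 ≤ ∑ x, ∑ y, G.adjMatrix ℝ x y * f x * f y := by
  have hA : (G.adjMatrix ℝ).IsHermitian := G.isSymm_adjMatrix ..
  have h := hA.neg.quadratic_le_of_eigenvalue_le (c := -G.lambdaMin) ?_ f
  · have e1 : f ⬝ᵥ (-G.adjMatrix ℝ).mulVec f =
        -∑ x, ∑ y, G.adjMatrix ℝ x y * f x * f y := by
      rw [Matrix.neg_mulVec, dotProduct_neg]
      simp only [dotProduct, Matrix.mulVec, mul_sum]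
      congr 1
      exact sum_congr rfl fun x _ => sum_congr rfl fun y _ => by ring
    have e2 : f ⬝ᵥ f = ∑ x, f x ^ 2 := sum_congr rfl fun x _ => by ring
    rw [e1, e2] at h
    linarith
  · intro μ v hv hμ
    rw [Matrix.neg_mulVec, neg_eq_iff_eq_neg, ← neg_smul] at hμ
    have hmem : -μ ∈ spectrum ℝ (G.adjMatrix ℝ) := by
      rw [← Matrix.spectrum_toLin']
      refine Module.End.HasEigenvalue.mem_spectrum
        (Module.End.hasEigenvalue_of_hasEigenvector (x := v) ⟨?_, hv⟩)
      rw [Module.End.mem_eigenspace_iff, Matrix.toLin'_apply, hμ]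
    rw [hA.spectrum_real_eq_range_eigenvalues] at hmem
    obtain ⟨i, hi⟩ := hmem
    have : G.lambdaMin ≤ hA.eigenvalues i := ciInf_le (Set.finite_range _).bddBelow i
    linarith

variable {G} in
theorem lambdaMin_le_neg_one_of_adj {u v : V} (h : G.Adj u v) : G.lambdaMin ≤ -1 := by
  have hne := h.ne
  -- Rayleigh quotient of the difference of the two endpoint indicators: `-2 / 2`.
  have := G.lambdaMin_mul_sum_sq_le (Pi.single u 1 - Pi.single v 1)
  have e1 : ∑ x, (Pi.single u 1 - Pi.single v 1 : V → ℝ) x ^ 2 = 2 := by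
    have : ∀ x, (Pi.single u 1 - Pi.single v 1 : V → ℝ) x ^ 2 =
        (if x = u then 1 else 0) + (if x = v then 1 else 0) := by
      intro x
      simp only [Pi.sub_apply, Pi.single_apply]
      by_cases hu : x = u
      · subst hu; simp [hne]
      · by_cases hv : x = v
        · subst hv; simp [hu]
        · simp [hu, hv]
    simp only [this, sum_add_distrib]
    norm_num
  have e2 : ∑ x, ∑ y, G.adjMatrix ℝ x y * (Pi.single u 1 - Pi.single v 1 : V → ℝ) x *
      (Pi.single u 1 - Pi.single v 1 : V → ℝ) y = -2 := by
    simp only [Pi.sub_apply, Pi.single_apply, mul_sub, sum_sub_distrib, mul_ite, mul_one,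
      mul_zero, sum_ite_eq', mem_univ, if_true]
    simp [h, h.symm]
    norm_num
  rw [e1, e2] at this
  linarith

variable {G} in
theorem mul_maxDegree_add_le {k : ℕ}
    (hkG : (k : ℝ) * ((G.maxDegree : ℝ) + |G.lambdaMin|) ≤ (Fintype.card V : ℝ)) {u v : V}
    (h : G.Adj u v) : k * (G.maxDegree + 1) ≤ Fintype.card V := by
  have h1 := lambdaMin_le_neg_one_of_adj h
  have h2 : 1 ≤ |G.lambdaMin| := by rw [abs_of_neg (by linarith)]; linarith
  have : (k : ℝ) * ((G.maxDegree : ℝ) + 1) ≤ (Fintype.card V : ℝ) :=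
    (mul_le_mul_of_nonneg_left (by linarith) k.cast_nonneg).trans hkG
  exact_mod_cast this

/-- Room for greedy extension. Without edges `hkG` gives nothing, and `k ≤ n` supplies the bound. -/
theorem pred_mul_maxDegree_add_lt {k : ℕ} (hk : 1 ≤ k) (hkn : k ≤ Fintype.card V)
    (hkG : (k : ℝ) * ((G.maxDegree : ℝ) + |G.lambdaMin|) ≤ (Fintype.card V : ℝ)) :
    (k - 1) * (G.maxDegree + 1) < Fintype.card V := by
  by_cases h : ∃ u v, G.Adj u v
  · obtain ⟨u, v, h⟩ := h
    refine lt_of_lt_of_le ?_ (mul_maxDegree_add_le hkG h)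
    exact Nat.mul_lt_mul_of_pos_right (by omega) (by omega)
  · push Not at h
    have : G.maxDegree = 0 := by
      refine Nat.le_zero.1 (G.maxDegree_le_of_forall_degree_le _ fun v => ?_)
      rw [← card_neighborFinset_eq_degree, Nat.le_zero, card_eq_zero, eq_empty_iff_forall_notMem]
      intro w hw
      exact h v w ((G.mem_neighborFinset v w).1 hw)
    rw [this]; omega

/-- The vertices that extend the vertex set `S` without creating an edge to `S`. -/
def extensions (S : Finset V) : Finset V :=
  univ.filter fun x => x ∉ S ∧ ∀ s ∈ S, ¬ G.Adj s x

variable {G} in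
theorem mem_extensions {S : Finset V} {x : V} :
    x ∈ G.extensions S ↔ x ∉ S ∧ ∀ s ∈ S, ¬ G.Adj s x := by simp [extensions]

/-- Each `s ∈ S` blocks only itself and its neighbours. -/
theorem card_le_card_extensions_add (S : Finset V) :
    Fintype.card V ≤ (G.extensions S).card + S.card * (G.maxDegree + 1) := by
  have h1 : (univ : Finset V) ⊆
      G.extensions S ∪ S.biUnion fun s => insert s (G.neighborFinset s) := by
    intro x _
    simp only [mem_union, mem_extensions, mem_biUnion, mem_insert, mem_neighborFinset]
    by_contra! hc
    obtain ⟨s, hs, hsx⟩ := hc.1 fun hx => (hc.2 x hx).1 rfl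
    exact (hc.2 s hs).2 hsx
  refine (card_le_card h1).trans ((card_union_le _ _).trans (Nat.add_le_add_left ?_ _))
  refine card_biUnion_le_card_mul _ _ _ fun s _ => (card_insert_le _ _).trans ?_
  rw [card_neighborFinset_eq_degree]
  exact Nat.add_le_add_right (G.degree_le_maxDegree s) 1

variable {G} in
theorem isIndepSet_insert_iff {S : Finset V} {x : V} (hx : x ∉ S) :
    G.IsIndepSet (insert x S : Finset V) ↔ G.IsIndepSet (S : Set V) ∧ x ∈ G.extensions S := by
  rw [coe_insert, isIndepSet_iff, isIndepSet_iff,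
    Set.pairwise_insert_of_notMem (by simpa using hx), mem_extensions]
  simp only [hx, not_false_eq_true, true_and, mem_coe, G.adj_comm x, and_self]

theorem mem_level_independentSetComplex {k : ℕ} {T : Finset V} :
    T ∈ (G.independentSetComplex k).level k ↔ T.card = k ∧ G.IsIndepSet (T : Set V) := by
  simp only [FaceComplex.level, independentSetComplex, mem_filter, mem_univ, true_and]
  exact ⟨fun h => ⟨h.2, h.1.2⟩, fun h => ⟨⟨h.1.le, h.2⟩, h.1⟩⟩

theorem card_of_mem_level {k : ℕ} :
    ∀ T ∈ (G.independentSetComplex k).level k, T.card = k := fun _ hT =>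
  (G.mem_level_independentSetComplex.1 hT).1

/-- Greedy: fewer than `k` chosen vertices cannot block all of `V`. Hence the complex is pure and
its weights are positive. -/
theorem exists_superset_mem_level {k : ℕ}
    (hn : (k - 1) * (G.maxDegree + 1) < Fintype.card V) (j : ℕ) :
    ∀ S : Finset V, S.card + j = k → G.IsIndepSet (S : Set V) →
      ∃ T ∈ (G.independentSetComplex k).level k, S ⊆ T := by
  induction j with
  | zero => exact fun S hS hi => ⟨S, G.mem_level_independentSetComplex.2 ⟨hS, hi⟩, Subset.rfl⟩
  | succ j ih =>
    intro S hS hi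
    have h1 := G.card_le_card_extensions_add S
    have h2 : S.card * (G.maxDegree + 1) ≤ (k - 1) * (G.maxDegree + 1) :=
      Nat.mul_le_mul_right _ (by omega)
    obtain ⟨x, hx⟩ := card_pos.1 (show 0 < (G.extensions S).card by omega)
    have hxS := (mem_extensions.1 hx).1
    obtain ⟨T, hT, hsub⟩ := ih (insert x S) (by rw [card_insert_of_notMem hxS]; omega)
      ((isIndepSet_insert_iff hxS).2 ⟨hi, hx⟩)
    exact ⟨T, hT, (subset_insert x S).trans hsub⟩

/-- The number of independent sets of size `k` that contain `S`. -/
noncomputable def indepCount (k : ℕ) (S : Finset V) : ℝ :=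
  faceSum ((G.independentSetComplex k).level k) (fun _ => 1) S

theorem indepCount_eq_card (k : ℕ) (S : Finset V) : G.indepCount k S =
    (((G.independentSetComplex k).level k).filter (S ⊆ ·)).card := by
  simp [indepCount, faceSum]

theorem indepCount_nonneg (k : ℕ) (S : Finset V) : 0 ≤ G.indepCount k S := by
  rw [indepCount_eq_card]; positivity

variable {G} in
theorem isIndepSet_of_indepCount_ne_zero {k : ℕ} {S : Finset V} (h : G.indepCount k S ≠ 0) :
    G.IsIndepSet (S : Set V) := by
  rw [indepCount_eq_card, Nat.cast_ne_zero, card_ne_zero] at h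
  obtain ⟨T, hT⟩ := h
  rw [mem_filter] at hT
  exact (G.mem_level_independentSetComplex.1 hT.1).2.mono (coe_subset.2 hT.2)

variable {G} in
theorem indepCount_pos {k : ℕ} (hn : (k - 1) * (G.maxDegree + 1) < Fintype.card V) {S : Finset V}
    (hS : S.card ≤ k) (hi : G.IsIndepSet (S : Set V)) : 0 < G.indepCount k S := by
  obtain ⟨T, hT, hsub⟩ := G.exists_superset_mem_level hn (k - S.card) S (by omega) hi
  rw [indepCount_eq_card, Nat.cast_pos, card_pos]
  exact ⟨T, mem_filter.2 ⟨hT, hsub⟩⟩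

theorem indepCount_of_card_eq {k : ℕ} {S : Finset V} (hS : S.card = k)
    (hi : G.IsIndepSet (S : Set V)) : G.indepCount k S = 1 := by
  rw [indepCount_eq_card, Nat.cast_eq_one, card_eq_one]
  refine ⟨S, ext fun T => ?_⟩
  rw [mem_filter, mem_singleton]
  constructor
  · rintro ⟨hT, hsub⟩
    exact (eq_of_subset_of_card_le hsub (by rw [G.card_of_mem_level T hT, hS])).symm
  · rintro rfl
    exact ⟨G.mem_level_independentSetComplex.2 ⟨hS, hi⟩, Subset.rfl⟩

variable {G} in
theorem linkEdge_indepCount_eq_zero {k : ℕ} {S : Finset V} {x y : V}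
    (h : ¬ (G.IsIndepSet (S : Set V) ∧ x ∈ G.extensions S ∧ y ∈ G.extensions S ∧ x ≠ y ∧
      ¬ G.Adj x y)) : linkEdge (G.indepCount k) S x y = 0 := by
  by_contra h0
  have hx : x ∉ S := fun hx => h0 (by simp [linkEdge, hx])
  have hy : y ∉ insert x S := fun hy => h0 (by simp [linkEdge, linkVertex, hx, hy])
  have hy' : y ≠ x ∧ y ∉ S := by simpa using hy
  rw [linkEdge_eq_of_mem hx hy'.2 hy'.1.symm] at h0
  have hi := (isIndepSet_insert_iff hy).1 (isIndepSet_of_indepCount_ne_zero h0)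
  have hi' := (isIndepSet_insert_iff hx).1 hi.1
  have hyx := (mem_extensions.1 hi.2).2
  exact h ⟨hi'.1, hi'.2, mem_extensions.2 ⟨hy'.2, fun s hs => hyx s (mem_insert_of_mem hs)⟩,
    hy'.1.symm, hyx x (mem_insert_self x S)⟩

variable {G} in
theorem isIndepSet_insert_insert {S : Finset V} {x y : V} (hi : G.IsIndepSet (S : Set V))
    (hx : x ∈ G.extensions S) (hy : y ∈ G.extensions S) (hxy : x ≠ y) (hadj : ¬ G.Adj x y) :
    G.IsIndepSet (insert y (insert x S) : Finset V) ∧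
      (insert y (insert x S)).card = S.card + 2 := by
  have hx' := mem_extensions.1 hx
  have hy' := mem_extensions.1 hy
  have hyn : y ∉ insert x S := by simp [hxy.symm, hy'.1]
  refine ⟨(isIndepSet_insert_iff hyn).2 ⟨(isIndepSet_insert_iff hx'.1).2 ⟨hi, hx⟩,
    mem_extensions.2 ⟨hyn, fun s hs => ?_⟩⟩, ?_⟩
  · rcases mem_insert.1 hs with rfl | hs
    · exact hadj
    · exact hy'.2 s hs
  · rw [card_insert_of_notMem hyn, card_insert_of_notMem hx'.1]

variable {G} in
theorem linkEdge_indepCount_pos {k : ℕ} (hn : (k - 1) * (G.maxDegree + 1) < Fintype.card V)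
    {S : Finset V} {x y : V} (hS : S.card + 2 ≤ k) (hi : G.IsIndepSet (S : Set V))
    (hx : x ∈ G.extensions S) (hy : y ∈ G.extensions S) (hxy : x ≠ y) (hadj : ¬ G.Adj x y) :
    0 < linkEdge (G.indepCount k) S x y := by
  have h := isIndepSet_insert_insert hi hx hy hxy hadj
  rw [linkEdge_eq_of_mem (mem_extensions.1 hx).1 (mem_extensions.1 hy).1 hxy]
  exact indepCount_pos hn (by omega) h.1

-- At codimension two the link weights are `0` or `1`: the adjacency matrix of the complement of
-- `G`, restricted to the extensions of `S`.
variable {G} in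
theorem linkEdge_indepCount_of_card {k : ℕ} {S : Finset V} (hS : S.card + 2 = k)
    (hi : G.IsIndepSet (S : Set V)) (x y : V) :
    linkEdge (G.indepCount k) S x y = (if x ∈ G.extensions S then 1 else 0) *
      (if y ∈ G.extensions S then 1 else 0) * (1 - (if x = y then 1 else 0) -
        G.adjMatrix ℝ x y) := by
  by_cases h : x ∈ G.extensions S ∧ y ∈ G.extensions S ∧ x ≠ y ∧ ¬ G.Adj x y
  · obtain ⟨hx, hy, hxy, hadj⟩ := h
    have h := isIndepSet_insert_insert hi hx hy hxy hadj
    rw [linkEdge_eq_of_mem (mem_extensions.1 hx).1 (mem_extensions.1 hy).1 hxy,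
      G.indepCount_of_card_eq (h.2.trans hS) h.1]
    simp [hx, hy, hxy, hadj]
  · rw [linkEdge_indepCount_eq_zero fun h' => h h'.2]
    by_cases hx : x ∈ G.extensions S <;> by_cases hy : y ∈ G.extensions S <;>
      by_cases hxy : x = y <;> by_cases hadj : G.Adj x y <;> simp_all

theorem isExpander_linkEdge_of_card {k : ℕ}
    (hkG : (k : ℝ) * ((G.maxDegree : ℝ) + |G.lambdaMin|) ≤ (Fintype.card V : ℝ))
    {S : Finset V} (hS : S.card + 2 = k) (hi : G.IsIndepSet (S : Set V)) :
    IsExpander (linkEdge (G.indepCount k) S) (1 / k) := by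
  have hk2 : (2 : ℝ) ≤ k := by exact_mod_cast (show 2 ≤ k by omega)
  have hk0 : (0 : ℝ) < k := by linarith
  refine IsExpander.of_forall_exists_sub_const ?_ (linkEdge_nonneg (G.indepCount_nonneg k) S)
    (linkEdge_comm _ S) fun f => ?_
  · rw [div_le_one hk0]; linarith
  set e : V → ℝ := fun x => if x ∈ G.extensions S then 1 else 0 with he
  have he0 : ∀ x, e x = 0 ∨ e x = 1 := fun x => by simp only [he]; split_ifs <;> simp
  have hw : ∀ x y, linkEdge (G.indepCount k) S x y =
      e x * e y * (1 - (if x = y then 1 else 0) - G.adjMatrix ℝ x y) :=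
    linkEdge_indepCount_of_card hS hi
  have hE : ∑ x, e x = (G.extensions S).card := by simp [he]
  -- The mean for counting measure on the extensions, not for the degrees: it kills the all-ones
  -- part of the complement's adjacency matrix.
  obtain ⟨m, hm⟩ : ∃ m : ℝ, ∑ x, e x * (f x - m) = 0 := by
    refine ⟨(∑ x, e x * f x) / ∑ x, e x, ?_⟩
    simp only [mul_sub, sum_sub_distrib, ← sum_mul]
    by_cases h0 : ∑ x, e x = 0
    · have : ∀ x, e x = 0 := fun x => (sum_eq_zero_iff_of_nonneg fun x _ => by
        rcases he0 x with h | h <;> simp [h]).1 h0 x (mem_univ x)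
      simp [this]
    · field_simp; ring
  refine ⟨m, ?_⟩
  set g : V → ℝ := fun x => e x * (f x - m) with hg
  have h1 : ∑ x, ∑ y, linkEdge (G.indepCount k) S x y * (f x - m) * (f y - m) =
      -∑ x, g x ^ 2 - ∑ x, ∑ y, G.adjMatrix ℝ x y * g x * g y := by
    calc _ = ∑ x, ∑ y, (g x * g y - (if x = y then g x * g y else 0) -
          G.adjMatrix ℝ x y * g x * g y) :=
          sum_congr rfl fun x _ => sum_congr rfl fun y _ => by
            rw [hw]; simp only [hg]; split_ifs <;> ring
      _ = _ := by
          simp only [sum_sub_distrib, ← mul_sum, sum_ite_eq, mem_univ, if_true]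
          rw [show ∑ y, g y = 0 from hm]
          simp [pow_two]
  have h2 := G.lambdaMin_mul_sum_sq_le g
  rw [h1, mul_sum]
  refine (show _ ≤ (-1 - G.lambdaMin) * ∑ x, g x ^ 2 by linarith).trans ?_
  rw [mul_sum]
  refine sum_le_sum fun x _ => ?_
  have hrow : ∑ y, linkEdge (G.indepCount k) S x y =
      e x * ((G.extensions S).card - e x - ∑ y, G.adjMatrix ℝ x y * e y) := by
    rw [← hE]
    simp only [hw]
    calc _ = ∑ y, e x * (e y - (if x = y then e y else 0) - G.adjMatrix ℝ x y * e y) :=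
          sum_congr rfl fun y _ => by split_ifs <;> ring
      _ = _ := by simp [← mul_sum, sum_sub_distrib]
  have hdeg : ∑ y, G.adjMatrix ℝ x y * e y ≤ G.maxDegree := by
    calc _ ≤ ∑ y, G.adjMatrix ℝ x y := sum_le_sum fun y _ => by
          rcases he0 y with h | h <;> simp [h, adjMatrix_apply]
          split_ifs <;> norm_num
      _ = G.degree x := by
          simp [adjMatrix_apply, ← card_neighborFinset_eq_degree, neighborFinset_eq_filter]
      _ ≤ _ := by exact_mod_cast G.degree_le_maxDegree x
  have hcard : (Fintype.card V : ℝ) ≤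
      (G.extensions S).card + (k - 2) * (G.maxDegree + 1) := by
    have := G.card_le_card_extensions_add S
    have hc : (S.card : ℝ) = k - 2 := by rw [← hS]; push_cast; ring
    rw [← hc]
    exact_mod_cast this
  rw [hrow]
  simp only [hg]
  rcases he0 x with h | h
  · simp [h]
  · rw [h, one_mul, one_mul, ← mul_assoc]
    -- What remains is `k * (-1 - λ) ≤ |extensions| - 1 - deg`, where `deg` is at most `Δ` and
    -- `|extensions| ≥ n - (k - 2) * (Δ + 1)`.
    refine mul_le_mul_of_nonneg_right ?_ (sq_nonneg _)
    rw [one_div, ← div_eq_inv_mul, le_div_iff₀ hk0]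
    have h5 : -G.lambdaMin ≤ |G.lambdaMin| := neg_le_abs _
    have h6 : k * -G.lambdaMin ≤ k * |G.lambdaMin| := mul_le_mul_of_nonneg_left h5 hk0.le
    have h7 : (0 : ℝ) ≤ G.maxDegree := Nat.cast_nonneg _
    nlinarith

theorem isExpander_linkEdge_of_not_isIndepSet {k : ℕ} {S : Finset V}
    (hi : ¬ G.IsIndepSet (S : Set V)) (γ : ℝ) :
    IsExpander (linkEdge (G.indepCount k) S) γ := by
  have : ∀ x y, linkEdge (G.indepCount k) S x y = 0 := fun x y =>
    linkEdge_indepCount_eq_zero fun h => hi h.1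
  intro f _
  simp [this]

theorem linkEdge_connected {k : ℕ} (hk : 1 ≤ k) (hkn : k ≤ Fintype.card V)
    (hkG : (k : ℝ) * ((G.maxDegree : ℝ) + |G.lambdaMin|) ≤ (Fintype.card V : ℝ))
    {S : Finset V} (hS : S.card + 2 ≤ k) (hi : G.IsIndepSet (S : Set V)) {x y : V}
    (hx : x ∈ G.extensions S) (hy : y ∈ G.extensions S) (hxy : x ≠ y) :
    0 < linkEdge (G.indepCount k) S x y ∨
      ∃ z, 0 < linkEdge (G.indepCount k) S x z ∧ 0 < linkEdge (G.indepCount k) S z y := by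
  have hn := G.pred_mul_maxDegree_add_lt hk hkn hkG
  by_cases hadj : G.Adj x y
  · right
    have h1 := mul_maxDegree_add_le hkG hadj
    have h2 := G.card_le_card_extensions_add S
    have h3 : (S.card + 2) * (G.maxDegree + 1) ≤ k * (G.maxDegree + 1) :=
      Nat.mul_le_mul_right _ hS
    have h4 : (G.neighborFinset x ∪ G.neighborFinset y).card ≤ 2 * G.maxDegree := by
      refine (card_union_le _ _).trans ?_
      rw [card_neighborFinset_eq_degree, card_neighborFinset_eq_degree]
      have := G.degree_le_maxDegree x
      have := G.degree_le_maxDegree y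
      omega
    -- At least `2 * (Δ + 1)` extensions exist, against at most `2 * Δ` neighbours of `x` or `y`. As
    -- `x` and `y` are adjacent, avoiding these neighbours also makes `z` differ from both.
    obtain ⟨z, hz, hz'⟩ := exists_mem_notMem_of_card_lt_card
      (show (G.neighborFinset x ∪ G.neighborFinset y).card < (G.extensions S).card by
        rw [add_mul] at h3; omega)
    simp only [mem_union, mem_neighborFinset, not_or] at hz'
    refine ⟨z, linkEdge_indepCount_pos hn hS hi hx hz ?_ hz'.1,
      linkEdge_indepCount_pos hn hS hi hz hy ?_ fun h => hz'.2 h.symm⟩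
    · rintro rfl; exact hz'.2 hadj.symm
    · rintro rfl; exact hz'.1 hadj
  · exact Or.inl (linkEdge_indepCount_pos hn hS hi hx hy hxy hadj)

/-- The link of every face `S` expands. -/
theorem isExpander_linkEdge {k : ℕ} (hk : 1 ≤ k) (hkn : k ≤ Fintype.card V)
    (hkG : (k : ℝ) * ((G.maxDegree : ℝ) + |G.lambdaMin|) ≤ (Fintype.card V : ℝ)) (j : ℕ) :
    ∀ S : Finset V, S.card + 2 + j = k →
      IsExpander (linkEdge (G.indepCount k) S) (1 / ((S.card : ℝ) + 2)) := by
  induction j with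
  | zero =>
    intro S hS
    by_cases hi : G.IsIndepSet (S : Set V)
    · have := G.isExpander_linkEdge_of_card hkG hS hi
      rwa [show (k : ℝ) = S.card + 2 by rw [← hS]; push_cast; ring] at this
    · exact G.isExpander_linkEdge_of_not_isIndepSet hi _
  | succ j ih =>
    intro S hS
    by_cases hi : G.IsIndepSet (S : Set V)
    swap
    · exact G.isExpander_linkEdge_of_not_isIndepSet hi _
    have hc : (0 : ℝ) ≤ S.card := Nat.cast_nonneg _
    have hj : (0 : ℝ) < j + 1 := by positivity
    -- Triangle weights of the link of `S`; those through `x` are the edge weights of the link of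
    -- `insert x S`.
    set t : V → V → V → ℝ := fun x y z =>
      if x ∈ S then 0 else linkEdge (G.indepCount k) (insert x S) y z with ht
    -- Summing triangles over the third vertex multiplies edge weights by `k - S.card - 2 = j + 1`;
    -- expansion does not depend on this factor, which is removed at the end.
    have hscale : IsExpander (fun x y => ((j : ℝ) + 1) * linkEdge (G.indepCount k) S x y)
        (1 / ((S.card : ℝ) + 3) / (1 - 1 / ((S.card : ℝ) + 3))) := by
      refine IsExpander.trickle_down (t := t) (by positivity) ?_ ?_ ?_ ?_ ?_ ?_ ?_
      · exact one_div_le_one_div_of_le (by norm_num) (by linarith)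
      · intro x y z
        simp only [ht]
        split_ifs
        exacts [le_rfl, linkEdge_nonneg (G.indepCount_nonneg k) _ _ _]
      · intro x y z
        exact linkEdge_comm (fun S' => linkVertex (G.indepCount k) S' z) S x y
      · intro x y z
        simp only [ht, linkEdge_comm _ _ y z]
      · intro x y
        simp only [ht, linkEdge]
        by_cases hx : x ∈ S
        · simp [hx]
        · simp only [hx, if_false]
          have := sum_linkEdge_faceSum (k := k) G.card_of_mem_level (fun _ => 1) (insert x S) y
          rw [card_insert_of_notMem hx] at this
          refine Eq.trans ?_ this.symm
          change _ * linkVertex (G.indepCount k) _ _ = _ * linkVertex (G.indepCount k) _ _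
          rw [← hS]; push_cast; ring
      · intro x
        by_cases hx : x ∈ S
        · intro f _
          simp [ht, hx]
        · have := ih (insert x S) (by rw [card_insert_of_notMem hx]; omega)
          rw [card_insert_of_notMem hx] at this
          push_cast at this
          rw [show (S.card : ℝ) + 1 + 2 = S.card + 3 by ring] at this
          simpa only [ht, hx, if_false] using this
      · intro x y hx hy hxy
        have hmem : ∀ x, 0 < ∑ z, ((j : ℝ) + 1) * linkEdge (G.indepCount k) S x z →
            x ∈ G.extensions S := by
          intro x hx
          obtain ⟨z, -, hz⟩ := exists_ne_zero_of_sum_ne_zero hx.ne'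
          by_contra hx'
          exact hz (by rw [linkEdge_indepCount_eq_zero fun h => hx' h.2.1, mul_zero])
        simp only [mul_pos_iff_of_pos_left hj]
        exact G.linkEdge_connected hk hkn hkG (by omega) hi (hmem x hx) (hmem y hy) hxy
    have hγ : 1 / ((S.card : ℝ) + 3) / (1 - 1 / ((S.card : ℝ) + 3)) =
        1 / ((S.card : ℝ) + 2) := by
      have h3 : (S.card : ℝ) + 3 ≠ 0 := by positivity
      rw [one_sub_div h3, show (S.card : ℝ) + 3 - 1 = S.card + 2 by ring]
      field_simp
    rw [hγ] at hscale
    intro f hf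
    have := hscale f (by
      simp only [← mul_sum, mul_assoc]
      rw [hf, mul_zero])
    simp only [← mul_sum, mul_assoc] at this
    rw [mul_left_comm, mul_le_mul_iff_right₀ hj] at this
    simpa only [mul_assoc] using this

end SimpleGraph

/-! ### Energies on the levels and the Poincaré inequality -/

namespace SimpleGraph

variable {V : Type*} [Fintype V] [DecidableEq V] (G : SimpleGraph V) [DecidableRel G.Adj]

/-- The sum of `f` over the independent sets of size `k` that contain `S`. -/
noncomputable def indepSum (k : ℕ) (f : Finset V → ℝ) (S : Finset V) : ℝ :=
  faceSum ((G.independentSetComplex k).level k) f S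

variable {G} in
theorem indepSum_eq_zero {k : ℕ} {f : Finset V → ℝ} {S : Finset V} (h : G.indepCount k S = 0) :
    G.indepSum k f S = 0 := by
  rw [indepCount_eq_card, Nat.cast_eq_zero, card_eq_zero] at h
  rw [indepSum, faceSum, h, sum_empty]

/-- The squared norm, over the faces with `c` elements, of the conditional expectation of `f`. -/
noncomputable def levelEnergy (k : ℕ) (f : Finset V → ℝ) (c : ℕ) : ℝ :=
  ∑ S ∈ powersetCard c (univ : Finset V), G.indepSum k f S ^ 2 / G.indepCount k S

/-- Variance contraction in the link of `S` for the edge function `indepSum / indepCount`; the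
factors `k - c` and `k - c - 1` come from the face-sum identities. -/
theorem link_variance_contraction {k c : ℕ} (hk : 1 ≤ k) (hkn : k ≤ Fintype.card V)
    (hkG : (k : ℝ) * ((G.maxDegree : ℝ) + |G.lambdaMin|) ≤ (Fintype.card V : ℝ))
    (f : Finset V → ℝ) {S : Finset V} (hS : S.card = c) (hc : c + 2 ≤ k) :
    ((k : ℝ) - c - 1) *
        ∑ x, linkVertex (fun S => G.indepSum k f S ^ 2 / G.indepCount k S) S x -
      ((k : ℝ) - c) * ((k : ℝ) - c - 1) * (G.indepSum k f S ^ 2 / G.indepCount k S) ≤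
    ((c : ℝ) + 3) / (2 * ((c : ℝ) + 2)) *
      (∑ x, ∑ y, linkEdge (fun S => G.indepSum k f S ^ 2 / G.indepCount k S) S x y -
      ((k : ℝ) - c) * ((k : ℝ) - c - 1) * (G.indepSum k f S ^ 2 / G.indepCount k S)) := by
  have hm : (2 : ℝ) ≤ (k : ℝ) - c := by
    have : ((c + 2 : ℕ) : ℝ) ≤ k := Nat.cast_le.2 hc
    push_cast at this; linarith
  have hm1 : (k : ℝ) - c - 1 ≠ 0 := by linarith
  have hm0 : (k : ℝ) - c ≠ 0 := by linarith
  have hexp := G.isExpander_linkEdge hk hkn hkG (k - c - 2) S (by omega)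
  have h := hexp.variance_contraction (a := linkEdge (G.indepSum k f) S) (by positivity)
    (linkEdge_nonneg (G.indepCount_nonneg k) S) (linkEdge_comm _ S) (linkEdge_comm _ S) (by
      intro x y hxy
      unfold linkEdge linkVertex at hxy ⊢
      split_ifs at hxy ⊢
      exacts [rfl, rfl, indepSum_eq_zero hxy])
  have ea : ∀ x, ∑ y, linkEdge (G.indepSum k f) S x y =
      ((k : ℝ) - c - 1) * linkVertex (G.indepSum k f) S x := fun x => by
    rw [← hS]; exact sum_linkEdge_faceSum G.card_of_mem_level f S x
  have ew : ∀ x, ∑ y, linkEdge (G.indepCount k) S x y =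
      ((k : ℝ) - c - 1) * linkVertex (G.indepCount k) S x := fun x => by
    rw [← hS]; exact sum_linkEdge_faceSum G.card_of_mem_level _ S x
  have ea' : ∑ x, linkVertex (G.indepSum k f) S x = ((k : ℝ) - c) * G.indepSum k f S := by
    rw [← hS]; exact sum_linkVertex_faceSum G.card_of_mem_level f S
  have ew' : ∑ x, linkVertex (G.indepCount k) S x = ((k : ℝ) - c) * G.indepCount k S := by
    rw [← hS]; exact sum_linkVertex_faceSum G.card_of_mem_level _ S
  simp only [ea, ew, ← mul_sum, ea', ew'] at h
  have e1 : ∑ x, (((k : ℝ) - c - 1) * linkVertex (G.indepSum k f) S x) ^ 2 /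
      (((k : ℝ) - c - 1) * linkVertex (G.indepCount k) S x) = ((k : ℝ) - c - 1) *
        ∑ x, linkVertex (fun S => G.indepSum k f S ^ 2 / G.indepCount k S) S x := by
    rw [mul_sum]
    refine sum_congr rfl fun x _ => ?_
    unfold linkVertex
    split_ifs
    · simp
    · rw [mul_pow, pow_two ((k : ℝ) - c - 1), mul_assoc, mul_div_mul_left _ _ hm1, mul_div_assoc]
  have e2 : ∑ x, ∑ y, linkEdge (G.indepSum k f) S x y ^ 2 / linkEdge (G.indepCount k) S x y =
      ∑ x, ∑ y, linkEdge (fun S => G.indepSum k f S ^ 2 / G.indepCount k S) S x y := by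
    refine sum_congr rfl fun x _ => sum_congr rfl fun y _ => ?_
    unfold linkEdge linkVertex
    split_ifs <;> simp
  have e3 : (((k : ℝ) - c - 1) * (((k : ℝ) - c) * G.indepSum k f S)) ^ 2 /
      (((k : ℝ) - c - 1) * (((k : ℝ) - c) * G.indepCount k S)) =
      ((k : ℝ) - c) * ((k : ℝ) - c - 1) * (G.indepSum k f S ^ 2 / G.indepCount k S) := by
    rw [← mul_assoc, ← mul_assoc, mul_pow, pow_two (((k : ℝ) - c - 1) * ((k : ℝ) - c)), mul_assoc,
      mul_div_mul_left _ _ (mul_ne_zero hm1 hm0), mul_div_assoc]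
    ring
  have e4 : (1 + 1 / ((S.card : ℝ) + 2)) / 2 = ((c : ℝ) + 3) / (2 * ((c : ℝ) + 2)) := by
    rw [hS]; field_simp; ring
  rwa [e1, e2, e3, e4] at h

theorem levelEnergy_step {k c : ℕ} (hk : 1 ≤ k) (hkn : k ≤ Fintype.card V)
    (hkG : (k : ℝ) * ((G.maxDegree : ℝ) + |G.lambdaMin|) ≤ (Fintype.card V : ℝ))
    (f : Finset V → ℝ) (hc : c + 2 ≤ k) :
    ((k : ℝ) - c - 1) * (((c : ℝ) + 1) * G.levelEnergy k f (c + 1)) -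
      ((k : ℝ) - c) * ((k : ℝ) - c - 1) * G.levelEnergy k f c ≤
    ((c : ℝ) + 3) / (2 * ((c : ℝ) + 2)) *
      (((c : ℝ) + 1) * (((c : ℝ) + 2) * G.levelEnergy k f (c + 2)) -
      ((k : ℝ) - c) * ((k : ℝ) - c - 1) * G.levelEnergy k f c) := by
  have h := sum_le_sum fun S (hS : S ∈ powersetCard c (univ : Finset V)) =>
    G.link_variance_contraction hk hkn hkG f (mem_powersetCard.1 hS).2 hc
  simp only [sum_sub_distrib, ← mul_sum] at h
  rwa [sum_powersetCard_linkVertex, sum_powersetCard_linkEdge] at h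

/-- The energy on level `c`, normalized so that all levels have the same total mass. -/
noncomputable def normalizedEnergy (k : ℕ) (f : Finset V → ℝ) (c : ℕ) : ℝ :=
  (c.factorial : ℝ) * (k - c).factorial * G.levelEnergy k f c

/-- With `E` the normalized energy, the summed link inequality is `2 * (c + 2) * (E (c + 1) - E c) ≤
(c + 3) * (E (c + 2) - E c)`; subtract `(c + 3) * (E (c + 1) - E c)` from both sides. -/
theorem normalizedEnergy_step {k c : ℕ} (hk : 1 ≤ k) (hkn : k ≤ Fintype.card V)
    (hkG : (k : ℝ) * ((G.maxDegree : ℝ) + |G.lambdaMin|) ≤ (Fintype.card V : ℝ))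
    (f : Finset V → ℝ) (hc : c + 2 ≤ k) :
    ((c : ℝ) + 1) * (G.normalizedEnergy k f (c + 1) - G.normalizedEnergy k f c) ≤
      ((c : ℝ) + 3) * (G.normalizedEnergy k f (c + 2) - G.normalizedEnergy k f (c + 1)) := by
  have h := G.levelEnergy_step hk hkn hkG f hc
  obtain ⟨j, rfl⟩ : ∃ j, k = c + 2 + j := ⟨k - (c + 2), by omega⟩
  have h' := mul_le_mul_of_nonneg_left h
    (show (0 : ℝ) ≤ (c.factorial : ℝ) * j.factorial by positivity)
  unfold normalizedEnergy
  rw [show c + 2 + j - (c + 1) = j + 1 by omega, show c + 2 + j - c = j + 2 by omega,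
    show c + 2 + j - (c + 2) = j by omega]
  simp only [Nat.factorial_succ]
  push_cast at h' ⊢
  set W0 := G.levelEnergy (c + 2 + j) f c
  set W1 := G.levelEnergy (c + 2 + j) f (c + 1)
  set W2 := G.levelEnergy (c + 2 + j) f (c + 2)
  have hc2 : (0 : ℝ) < 2 * ((c : ℝ) + 2) := by positivity
  have h2 := mul_le_mul_of_nonneg_left h' hc2.le
  have e : 2 * ((c : ℝ) + 2) * ((c.factorial : ℝ) * j.factorial *
      (((c : ℝ) + 3) / (2 * ((c : ℝ) + 2)) * (((c : ℝ) + 1) * (((c : ℝ) + 2) * W2) -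
        ((c : ℝ) + 2 + j - c) * ((c : ℝ) + 2 + j - c - 1) * W0))) =
      (c.factorial : ℝ) * j.factorial * (((c : ℝ) + 3) * (((c : ℝ) + 1) * (((c : ℝ) + 2) * W2) -
        ((c : ℝ) + 2 + j - c) * ((c : ℝ) + 2 + j - c - 1) * W0)) := by
    field_simp
  rw [e] at h2
  linear_combination h2

/-- Telescoping: the increments satisfy `normalizedEnergy_step`, and `(c + 1) * (c + 3) + 1 = (c +
2) ^ 2` closes the induction. -/
theorem normalizedEnergy_sub_le {k : ℕ} (hk : 1 ≤ k) (hkn : k ≤ Fintype.card V)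
    (hkG : (k : ℝ) * ((G.maxDegree : ℝ) + |G.lambdaMin|) ≤ (Fintype.card V : ℝ))
    (f : Finset V → ℝ) (c : ℕ) (hc : c + 1 ≤ k) :
    G.normalizedEnergy k f (c + 1) - G.normalizedEnergy k f 0 ≤
      ((c : ℝ) + 1) ^ 2 * (G.normalizedEnergy k f (c + 1) - G.normalizedEnergy k f c) := by
  induction c with
  | zero => simp
  | succ c ih =>
    have h1 := ih (by omega)
    have h2 := G.normalizedEnergy_step hk hkn hkG f (c := c) (by omega)
    have h3 := mul_le_mul_of_nonneg_left h2 (show (0 : ℝ) ≤ (c : ℝ) + 1 by positivity)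
    push_cast
    linear_combination h1 + h3

theorem levelEnergy_top (k : ℕ) (f : Finset V → ℝ) :
    G.levelEnergy k f k = ∑ T ∈ (G.independentSetComplex k).level k, f T ^ 2 := by
  have hsub : (G.independentSetComplex k).level k ⊆ powersetCard k (univ : Finset V) := fun T hT =>
    mem_powersetCard.2 ⟨subset_univ T, G.card_of_mem_level T hT⟩
  rw [levelEnergy, ← sum_subset hsub]
  · refine sum_congr rfl fun T hT => ?_
    have hT' := G.mem_level_independentSetComplex.1 hT
    have : G.indepSum k f T = f T := by
      rw [indepSum, faceSum, sum_eq_single T]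
      · intro T' h hne
        rw [mem_filter] at h
        exact absurd (eq_of_subset_of_card_le h.2
          (by rw [G.card_of_mem_level T' h.1, hT'.1])).symm hne
      · intro h
        exact absurd (mem_filter.2 ⟨hT, Subset.rfl⟩) h
    rw [this, G.indepCount_of_card_eq hT'.1 hT'.2, div_one]
  · intro T hT hT'
    have : G.indepCount k T = 0 := by
      by_contra h
      exact hT' (G.mem_level_independentSetComplex.2
        ⟨(mem_powersetCard.1 hT).2, isIndepSet_of_indepCount_ne_zero h⟩)
    rw [this, div_zero]

/-- The Poincaré inequality for the down-up walk on the independent sets of size `k`. -/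
theorem levelEnergy_pred_le {k : ℕ} (hk : 1 ≤ k) (hkn : k ≤ Fintype.card V)
    (hkG : (k : ℝ) * ((G.maxDegree : ℝ) + |G.lambdaMin|) ≤ (Fintype.card V : ℝ))
    (f : Finset V → ℝ) (hf : ∑ T ∈ (G.independentSetComplex k).level k, f T = 0) :
    G.levelEnergy k f (k - 1) / k ≤
      (1 - 1 / (k : ℝ) ^ 2) * ∑ T ∈ (G.independentSetComplex k).level k, f T ^ 2 := by
  obtain ⟨c, rfl⟩ : ∃ c, k = c + 1 := ⟨k - 1, by omega⟩
  have h := G.normalizedEnergy_sub_le hk hkn hkG f c le_rfl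
  -- The only face on level `0` is empty, where the conditional expectation is the mean of `f`.
  have h0 : G.levelEnergy (c + 1) f 0 = 0 := by
    simp [levelEnergy, indepSum, faceSum, hf]
  rw [← levelEnergy_top]
  unfold normalizedEnergy at h
  rw [h0, show c + 1 - (c + 1) = 0 by omega, show c + 1 - c = 1 by omega,
    Nat.factorial_succ, Nat.factorial_zero, Nat.factorial_one] at h
  rw [Nat.add_sub_cancel]
  push_cast at h ⊢
  have hc : (0 : ℝ) < c + 1 := by positivity
  have hfac : (0 : ℝ) < c.factorial := by positivity
  have h' : (c.factorial : ℝ) * (((c : ℝ) + 1) * G.levelEnergy (c + 1) f (c + 1)) ≤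
      (c.factorial : ℝ) * (((c : ℝ) + 1) ^ 2 * (((c : ℝ) + 1) * G.levelEnergy (c + 1) f (c + 1) -
        G.levelEnergy (c + 1) f c)) := by
    linear_combination h
  have h2 := le_of_mul_le_mul_left h' hfac
  rw [div_le_iff₀ hc, one_sub_div (by positivity), div_mul_eq_mul_div, div_mul_eq_mul_div,
    le_div_iff₀ (by positivity)]
  linear_combination h2

end SimpleGraph

/-! ### Convergence of symmetric positive semidefinite walks -/

namespace Matrix

variable {ι : Type*} [Fintype ι]

/-- On mean-zero functions the spectrum lies in `[0, r]`, hence that of `P ^ 2` in `[0, r ^ 2]`.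
Diagonalization is avoided by testing positivity at `f - s • (P *ᵥ f)` with `s = 1 / r`, or `s = 1`
when `r = 0`. -/
theorem sum_mulVec_sq_le_of_posSemidef {P : Matrix ι ι ℝ} {r : ℝ} (hr : 0 ≤ r)
    (hs : ∀ x y, P x y = P y x) (hpos : ∀ f : ι → ℝ, 0 ≤ f ⬝ᵥ (P *ᵥ f))
    (hgap : ∀ f : ι → ℝ, ∑ x, f x = 0 → f ⬝ᵥ (P *ᵥ f) ≤ r * (f ⬝ᵥ f)) {f : ι → ℝ}
    (hf : ∑ x, f x = 0) (hPf : ∑ x, (P *ᵥ f) x = 0) :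
    (P *ᵥ f) ⬝ᵥ (P *ᵥ f) ≤ r ^ 2 * (f ⬝ᵥ f) := by
  have hsymm : f ⬝ᵥ (P *ᵥ (P *ᵥ f)) = (P *ᵥ f) ⬝ᵥ (P *ᵥ f) := by
    rw [dotProduct_mulVec, ← mulVec_transpose]
    congr 2
    ext x y
    exact hs y x
  have h : ∀ s : ℝ, 0 ≤ f ⬝ᵥ (P *ᵥ f) - 2 * s * ((P *ᵥ f) ⬝ᵥ (P *ᵥ f)) +
      s ^ 2 * ((P *ᵥ f) ⬝ᵥ (P *ᵥ (P *ᵥ f))) := by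
    intro s
    have := hpos (f - s • (P *ᵥ f))
    simp only [mulVec_sub, mulVec_smul, dotProduct_sub, sub_dotProduct, dotProduct_smul,
      smul_dotProduct, smul_eq_mul, hsymm] at this
    linear_combination this
  have h1 := hgap f hf
  have h2 := hgap (P *ᵥ f) hPf
  rcases hr.eq_or_lt with rfl | hr
  · have := h 1
    linarith
  · have h3 := h (1 / r)
    have h4 : (1 / r) ^ 2 * ((P *ᵥ f) ⬝ᵥ (P *ᵥ (P *ᵥ f))) ≤
        (1 / r) * ((P *ᵥ f) ⬝ᵥ (P *ᵥ f)) := by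
      calc _ ≤ (1 / r) ^ 2 * (r * ((P *ᵥ f) ⬝ᵥ (P *ᵥ f))) := by gcongr
        _ = _ := by field_simp
    have h5 : (1 / r) * ((P *ᵥ f) ⬝ᵥ (P *ᵥ f)) ≤ r * (f ⬝ᵥ f) := by linarith
    rw [one_div, inv_mul_le_iff₀ hr] at h5
    linarith

variable [DecidableEq ι]

/-- A symmetric positive semidefinite random walk with spectral gap `1 - r` converges to the
uniform distribution at rate `r`. -/
theorem sum_abs_pow_sub_le {P : Matrix ι ι ℝ} {r : ℝ} (hr : 0 ≤ r)
    (hs : ∀ x y, P x y = P y x) (hrow : ∀ x, ∑ y, P x y = 1)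
    (hpos : ∀ f : ι → ℝ, 0 ≤ f ⬝ᵥ (P *ᵥ f))
    (hgap : ∀ f : ι → ℝ, ∑ x, f x = 0 → f ⬝ᵥ (P *ᵥ f) ≤ r * (f ⬝ᵥ f)) (t : ℕ) (x : ι) :
    ∑ y, |(P ^ t) x y - 1 / (Fintype.card ι : ℝ)| ≤ √((Fintype.card ι : ℝ) - 1) * r ^ t := by
  set N : ℝ := (Fintype.card ι : ℝ) with hN
  have : Nonempty ι := ⟨x⟩
  have hN0 : N ≠ 0 := Nat.cast_ne_zero.2 Fintype.card_ne_zero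
  have hN1 : 1 ≤ N := Nat.one_le_cast.2 Fintype.card_pos
  set g : ℕ → ι → ℝ := fun t y => (P ^ t) x y - 1 / N with hg
  -- Symmetry lets a row of `P ^ t` evolve by multiplication on the left.
  have hsucc : ∀ t, g (t + 1) = P *ᵥ g t := by
    intro t
    ext y
    simp only [hg, pow_succ, mul_apply, mulVec, dotProduct, mul_sub, sum_sub_distrib, ← sum_mul,
      hrow, one_mul]
    congr 1
    exact sum_congr rfl fun z _ => by rw [hs z y, mul_comm]
  have hsumP : ∀ f : ι → ℝ, ∑ y, (P *ᵥ f) y = ∑ y, f y := by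
    intro f
    simp only [mulVec, dotProduct]
    rw [sum_comm]
    refine sum_congr rfl fun y _ => ?_
    rw [← sum_mul]
    simp only [hs _ y, hrow, one_mul]
  have hmean : ∀ t, ∑ y, g t y = 0 := by
    intro t
    induction t with
    | zero => simp [hg, one_apply, sum_sub_distrib, ← hN, hN0]
    | succ t ih => rw [hsucc, hsumP, ih]
  have hnorm : ∀ t, g t ⬝ᵥ g t ≤ (1 - 1 / N) * (r ^ t) ^ 2 := by
    intro t
    induction t with
    | zero =>
      have : g 0 ⬝ᵥ g 0 = ∑ y, ((if x = y then 1 - 2 / N else 0) + 1 / N ^ 2) := by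
        refine sum_congr rfl fun y _ => ?_
        simp only [hg, pow_zero, one_apply]
        split_ifs <;> ring
      rw [this, sum_add_distrib, sum_ite_eq, sum_const, card_univ, nsmul_eq_mul, ← hN]
      simp only [mem_univ, if_true, pow_zero]
      refine le_of_eq ?_
      field_simp
      ring
    | succ t ih =>
      rw [hsucc]
      refine (sum_mulVec_sq_le_of_posSemidef hr hs hpos hgap (hmean t)
        ((hsumP _).trans (hmean t))).trans ?_
      calc r ^ 2 * (g t ⬝ᵥ g t) ≤ r ^ 2 * ((1 - 1 / N) * (r ^ t) ^ 2) := by gcongr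
        _ = _ := by ring
  -- Cauchy-Schwarz costs a factor `N`, and `N * (1 - 1 / N) = N - 1`.
  have hcs : (∑ y, |g t y|) ^ 2 ≤ (√(N - 1) * r ^ t) ^ 2 := by
    calc (∑ y, |g t y|) ^ 2 ≤ N * ∑ y, |g t y| ^ 2 := by
          have := sq_sum_le_card_mul_sum_sq (s := univ) (f := fun y => |g t y|)
          rwa [card_univ] at this
      _ = N * (g t ⬝ᵥ g t) := by
          congr 1; exact sum_congr rfl fun y _ => by rw [sq_abs, pow_two]
      _ ≤ N * ((1 - 1 / N) * (r ^ t) ^ 2) := by gcongr; exact hnorm t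
      _ = _ := by rw [mul_pow, Real.sq_sqrt (by linarith)]; field_simp
  exact le_of_sq_le_sq hcs (by positivity)

end Matrix

/-! ### The down-up walk on independent sets -/

namespace SimpleGraph

variable {V : Type*} [Fintype V] [DecidableEq V] (G : SimpleGraph V) [DecidableRel G.Adj]

theorem mem_level_pred {k : ℕ} {α : Finset V} {β : Finset V}
    (hβ : β ∈ (G.independentSetComplex k).level k) (hα : α.card = k - 1) (h : α ⊆ β) :
    α ∈ (G.independentSetComplex k).level (k - 1) := by
  have hi := (G.mem_level_independentSetComplex.1 hβ).2.mono (coe_subset.2 h)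
  simp only [FaceComplex.level, independentSetComplex, mem_filter, mem_univ, true_and]
  exact ⟨⟨by omega, hi⟩, hα⟩

theorem levelWeight_pred {k : ℕ} (hk : 1 ≤ k) {α : Finset V} (hα : α.card = k - 1) :
    (G.independentSetComplex k).levelWeight k
      (uniformOn ((G.independentSetComplex k).level k)) (k - 1) α =
      1 / k * (G.indepCount k α / ((G.independentSetComplex k).level k).card) := by
  have h1 : k - (k - 1) = 0 + 1 := by omega
  have h2 : α.card + 1 = k := by omega
  have h3 : (α.card : ℝ) + 1 = k := by exact_mod_cast h2
  rw [FaceComplex.levelWeight, h1, FaceComplex.marginal, h3, h2]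
  congr 1
  rw [indepCount, faceSum, sum_div]
  refine sum_congr rfl fun T hT => ?_
  rw [FaceComplex.marginal, uniformOn, if_pos (mem_filter.1 hT).1]

/-- The uniform weights cancel, leaving a nonnegative combination of rank-one kernels indexed by
`α`; symmetry and positivity are then visible. Sets `α` that are not faces lie in no `β`, so they
may be included. -/
theorem independentSetWalk_apply {k : ℕ} (hk : 1 ≤ k)
    (β β' : {S // S ∈ (G.independentSetComplex k).level k}) :
    G.independentSetWalk k β β' = ∑ α ∈ powersetCard (k - 1) (univ : Finset V),
      (if α ⊆ β.1 then 1 else 0) * (if α ⊆ β'.1 then 1 else 0) *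
        (1 / ((k : ℝ) * G.indepCount k α)) := by
  have hk0 : (k : ℝ) ≠ 0 := Nat.cast_ne_zero.2 (by omega)
  have hI : (((G.independentSetComplex k).level k).card : ℝ) ≠ 0 :=
    Nat.cast_ne_zero.2 (card_ne_zero_of_mem β.2)
  have hsub : (G.independentSetComplex k).level (k - 1) ⊆
      powersetCard (k - 1) (univ : Finset V) := fun T hT =>
    mem_powersetCard.2 ⟨subset_univ T, (mem_filter.1 hT).2⟩
  rw [← sum_subset hsub, ← sum_coe_sort, independentSetWalk, FaceComplex.downUpWalk,
    Matrix.mul_apply]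
  · refine sum_congr rfl fun α _ => ?_
    have hα : α.1.card = k - 1 := (mem_filter.1 α.2).2
    simp only [FaceComplex.upOp, FaceComplex.downOp, Matrix.of_apply, G.levelWeight_pred hk hα]
    rw [FaceComplex.levelWeight, Nat.sub_self, FaceComplex.marginal, uniformOn, if_pos β'.2]
    split_ifs
    · by_cases hN : G.indepCount k α.1 = 0
      · simp [hN]
      · field_simp
    all_goals simp
  · intro α hα hα'
    rw [if_neg, zero_mul, zero_mul]
    exact fun h => hα' (G.mem_level_pred β.2 (mem_powersetCard.1 hα).2 h)

theorem sum_level_subset {k : ℕ} (f : {S // S ∈ (G.independentSetComplex k).level k} → ℝ)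
    (F : Finset V → ℝ) (hF : ∀ S, f S = F S.1) (α : Finset V) :
    ∑ β, (if α ⊆ β.1 then 1 else 0) * f β = G.indepSum k F α := by
  simp only [hF]
  rw [sum_coe_sort _ fun β => (if α ⊆ β then 1 else 0) * F β, indepSum, faceSum, sum_filter]
  exact sum_congr rfl fun β _ => by split_ifs <;> simp

theorem independentSetWalk_comm {k : ℕ} (hk : 1 ≤ k)
    (β β' : {S // S ∈ (G.independentSetComplex k).level k}) :
    G.independentSetWalk k β β' = G.independentSetWalk k β' β := by
  rw [G.independentSetWalk_apply hk, G.independentSetWalk_apply hk]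
  exact sum_congr rfl fun α _ => by ring

theorem independentSetWalk_row_sum {k : ℕ} (hk : 1 ≤ k)
    (β : {S // S ∈ (G.independentSetComplex k).level k}) :
    ∑ β', G.independentSetWalk k β β' = 1 := by
  have hk0 : (k : ℝ) ≠ 0 := Nat.cast_ne_zero.2 (by omega)
  simp only [G.independentSetWalk_apply hk]
  rw [sum_comm]
  have h1 : ∀ α ∈ powersetCard (k - 1) (univ : Finset V),
      ∑ β' : {S // S ∈ (G.independentSetComplex k).level k},
      (if α ⊆ β.1 then (1 : ℝ) else 0) * (if α ⊆ β'.1 then 1 else 0) *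
        (1 / ((k : ℝ) * G.indepCount k α)) = if α ⊆ β.1 then 1 / (k : ℝ) else 0 := by
    intro α _
    have h2 := G.sum_level_subset (k := k) (fun _ => 1) (fun _ => 1) (fun _ => rfl) α
    change _ = G.indepCount k α at h2
    simp only [mul_one] at h2
    rw [← sum_mul, ← mul_sum, h2]
    split_ifs with h
    · have : G.indepCount k α ≠ 0 := by
        rw [indepCount_eq_card]
        exact Nat.cast_ne_zero.2 (card_ne_zero_of_mem (mem_filter.2 ⟨β.2, h⟩))
      field_simp
    · simp
  rw [sum_congr rfl h1, ← sum_filter]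
  have h3 : (powersetCard (k - 1) (univ : Finset V)).filter (· ⊆ β.1) =
      powersetCard (k - 1) β.1 := by
    ext α
    simp [mem_powersetCard, and_comm]
  rw [h3, sum_const, card_powersetCard, G.card_of_mem_level β.1 β.2, nsmul_eq_mul,
    Nat.choose_symm hk, Nat.choose_one_right]
  field_simp

theorem dotProduct_independentSetWalk_mulVec {k : ℕ} (hk : 1 ≤ k)
    (f : {S // S ∈ (G.independentSetComplex k).level k} → ℝ)
    (F : Finset V → ℝ) (hF : ∀ S, f S = F S.1) :
    f ⬝ᵥ (G.independentSetWalk k).mulVec f = G.levelEnergy k F (k - 1) / k := by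
  calc _ = ∑ α ∈ powersetCard (k - 1) (univ : Finset V), ∑ β, ∑ β',
        (if α ⊆ β.1 then 1 else 0) * f β * ((if α ⊆ β'.1 then 1 else 0) * f β') *
          (1 / ((k : ℝ) * G.indepCount k α)) := by
        simp only [dotProduct, Matrix.mulVec, G.independentSetWalk_apply hk, mul_sum, sum_mul]
        simp only [sum_comm (s := (univ : Finset {S // S ∈ (G.independentSetComplex k).level k}))
          (t := powersetCard (k - 1) (univ : Finset V))]
        exact sum_congr rfl fun α _ => sum_congr rfl fun β _ => sum_congr rfl fun β' _ => by ring
    _ = _ := by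
        rw [levelEnergy, sum_div]
        refine sum_congr rfl fun α _ => ?_
        simp only [← sum_mul, ← mul_sum, G.sum_level_subset f F hF]
        rw [div_div, mul_comm (k : ℝ)]
        ring

theorem exists_extend_level {k : ℕ} (f : {S // S ∈ (G.independentSetComplex k).level k} → ℝ) :
    ∃ F : Finset V → ℝ, ∀ S, f S = F S.1 :=
  ⟨fun S => if h : S ∈ (G.independentSetComplex k).level k then f ⟨S, h⟩ else 0,
    fun S => by simp⟩

/-- The convergence rate of the down-up walk on the independent sets of size `k`. -/
theorem sum_abs_independentSetWalk_pow_sub_le {k : ℕ} (hk : 1 ≤ k) (hkn : k ≤ Fintype.card V)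
    (hkG : (k : ℝ) * ((G.maxDegree : ℝ) + |G.lambdaMin|) ≤ (Fintype.card V : ℝ)) (t : ℕ)
    (S : {S // S ∈ (G.independentSetComplex k).level k}) :
    ∑ S', |(G.independentSetWalk k ^ t) S S' -
        uniformOn ((G.independentSetComplex k).level k) S'.1| ≤
      √((((G.independentSetComplex k).level k).card : ℝ) - 1) * (1 - 1 / (k : ℝ) ^ 2) ^ t := by
  have hk1 : (1 : ℝ) ≤ k := Nat.one_le_cast.2 hk
  have h := Matrix.sum_abs_pow_sub_le (P := G.independentSetWalk k) (r := 1 - 1 / (k : ℝ) ^ 2)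
    (by rw [sub_nonneg, div_le_one (by positivity)]; exact one_le_pow₀ hk1)
    (G.independentSetWalk_comm hk) (G.independentSetWalk_row_sum hk) ?_ ?_ t S
  · rw [Fintype.card_coe] at h
    refine le_of_eq_of_le (sum_congr rfl fun S' _ => ?_) h
    rw [uniformOn, if_pos S'.2]
  · intro f
    obtain ⟨F, hF⟩ := G.exists_extend_level f
    rw [G.dotProduct_independentSetWalk_mulVec hk f F hF]
    exact div_nonneg (sum_nonneg fun S _ =>
      div_nonneg (sq_nonneg _) (G.indepCount_nonneg k S)) (by positivity)
  · intro f hf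
    obtain ⟨F, hF⟩ := G.exists_extend_level f
    rw [G.dotProduct_independentSetWalk_mulVec hk f F hF]
    have e1 : ∑ T ∈ (G.independentSetComplex k).level k, F T = 0 := by
      rw [← hf, ← sum_coe_sort]
      exact sum_congr rfl fun T _ => (hF T).symm
    have e2 : f ⬝ᵥ f = ∑ T ∈ (G.independentSetComplex k).level k, F T ^ 2 := by
      rw [← sum_coe_sort]
      exact sum_congr rfl fun T _ => by rw [hF T, pow_two]
    rw [e2]
    exact G.levelEnergy_pred_le hk hkn hkG F e1

theorem card_level_le (k : ℕ) :
    ((G.independentSetComplex k).level k).card ≤ Fintype.card V ^ k := by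
  have hsub : (G.independentSetComplex k).level k ⊆ powersetCard k (univ : Finset V) := fun T hT =>
    mem_powersetCard.2 ⟨subset_univ T, G.card_of_mem_level T hT⟩
  refine (card_le_card hsub).trans ?_
  rw [card_powersetCard, card_univ]
  exact Nat.choose_le_pow _ _

/-- The walk is `ε`-close to uniform as soon as the exponential bound on its distance is. -/
theorem epsClose_of_exp_le {k : ℕ} (hk : 1 ≤ k) (hkn : k ≤ Fintype.card V)
    (hkG : (k : ℝ) * ((G.maxDegree : ℝ) + |G.lambdaMin|) ≤ (Fintype.card V : ℝ)) {ε : ℝ} {t : ℕ}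
    (ht : √((Fintype.card V : ℝ) ^ k) * Real.exp (-(t / (k : ℝ) ^ 2)) ≤ ε)
    (S : {S // S ∈ (G.independentSetComplex k).level k}) :
    EpsClose ε ((G.independentSetWalk k ^ t) S)
      (fun S => uniformOn ((G.independentSetComplex k).level k) S.1) := by
  have hk1 : (1 : ℝ) ≤ k := Nat.one_le_cast.2 hk
  refine (G.sum_abs_independentSetWalk_pow_sub_le hk hkn hkG t S).trans (le_trans ?_ ht)
  have h1 : (((G.independentSetComplex k).level k).card : ℝ) - 1 ≤ (Fintype.card V : ℝ) ^ k := by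
    have : (((G.independentSetComplex k).level k).card : ℝ) ≤ (Fintype.card V : ℝ) ^ k := by
      exact_mod_cast G.card_level_le k
    linarith
  have h2 : (1 - 1 / (k : ℝ) ^ 2) ^ t ≤ Real.exp (-(t / (k : ℝ) ^ 2)) := by
    calc _ ≤ Real.exp (-(1 / (k : ℝ) ^ 2)) ^ t := by
          refine pow_le_pow_left₀ ?_ (Real.one_sub_le_exp_neg _) t
          rw [sub_nonneg, div_le_one (by positivity)]; exact one_le_pow₀ hk1
      _ = _ := by rw [← Real.exp_nat_mul]; congr 1; ring
  exact mul_le_mul (Real.sqrt_le_sqrt h1) h2 (by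
    refine pow_nonneg ?_ t
    rw [sub_nonneg, div_le_one (by positivity)]; exact one_le_pow₀ hk1) (Real.sqrt_nonneg _)

end SimpleGraph

/-! ### The mixing time -/

theorem mainTheorem9 {V : Type*} [Fintype V] [DecidableEq V] (G : SimpleGraph V)
    [DecidableRel G.Adj] (k : ℕ) (hk : 1 ≤ k) (hkn : k ≤ Fintype.card V)
    (hkG : (k : ℝ) * ((G.maxDegree : ℝ) + |G.lambdaMin|) ≤ (Fintype.card V : ℝ))
    (ε : ℝ) (hε : 0 < ε) :
    let n : ℕ := Fintype.card V
    let P := G.independentSetWalk k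
    let unif : {S // S ∈ (G.independentSetComplex k).level k} → ℝ :=
      fun S => uniformOn ((G.independentSetComplex k).level k) S.1
    let T : ℕ := mixingTime ε P unif
    let B : ℝ := (k : ℝ) ^ 2 * (Real.log (1 / ε) + (k : ℝ) * Real.log (n : ℝ))
    ((G.independentSetComplex k).level k).Nonempty ∧
      (∀ S, EpsClose ε ((P ^ T) S) unif) ∧
      T ≤ ⌈B⌉₊ ∧
      (ε ≤ 1 → ¬ (n = 2 ∧ k = 1 ∧ 2 / Real.exp 1 < ε ∧ ε < 1) → (T : ℝ) ≤ B) := by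
  intro n P unif T B
  have hk1 : (1 : ℝ) ≤ k := Nat.one_le_cast.2 hk
  have hn1 : (1 : ℝ) ≤ n := Nat.one_le_cast.2 (hk.trans hkn)
  have hn0 : (0 : ℝ) < n := by linarith
  have hT : ∀ t : ℕ, (∀ S, EpsClose ε ((P ^ t) S) unif) → T ≤ t := fun t ht => Nat.sInf_le ht
  have hnk1 : (1 : ℝ) ≤ (n : ℝ) ^ k := one_le_pow₀ hn1
  have hexpB : Real.exp (-(B / (k : ℝ) ^ 2)) = ε / (n : ℝ) ^ k := by
    have : B / (k : ℝ) ^ 2 = Real.log ((n : ℝ) ^ k / ε) := by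
      rw [Real.log_div (by positivity) hε.ne', Real.log_pow, mul_div_cancel_left₀ _ (by positivity),
        one_div, Real.log_inv]
      ring
    rw [this, ← Real.log_inv, Real.exp_log (by positivity), inv_div]
  have hceil : ∀ S, EpsClose ε ((P ^ ⌈B⌉₊) S) unif := by
    refine G.epsClose_of_exp_le hk hkn hkG ?_
    have h1 : Real.exp (-((⌈B⌉₊ : ℝ) / (k : ℝ) ^ 2)) ≤ ε / (n : ℝ) ^ k := by
      rw [← hexpB]
      gcongr
      exact Nat.le_ceil B
    have h2 : √((n : ℝ) ^ k) ≤ (n : ℝ) ^ k :=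
      Real.sqrt_le_iff.2 ⟨by positivity, le_self_pow₀ hnk1 two_ne_zero⟩
    calc _ ≤ (n : ℝ) ^ k * (ε / (n : ℝ) ^ k) := mul_le_mul h2 h1 (Real.exp_pos _).le (by positivity)
      _ = ε := by field_simp
  refine ⟨?_, Nat.sInf_mem (s := {t : ℕ | ∀ S, EpsClose ε ((P ^ t) S) unif}) ⟨_, hceil⟩,
    hT _ hceil, fun hε1 hexc => ?_⟩
  · obtain ⟨S, hS, -⟩ := G.exists_superset_mem_level
      (G.pred_mul_maxDegree_add_lt hk hkn hkG) k ∅ (by simp) (by simp)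
    exact ⟨S, hS⟩
  · have hlogε : 0 ≤ Real.log (1 / ε) := Real.log_nonneg ((one_le_div hε).2 hε1)
    have hlogn : 0 ≤ Real.log n := Real.log_nonneg hn1
    have hB0 : 0 ≤ B := by positivity
    rcases hk.eq_or_lt with rfl | hk2
    · have hB : B = Real.log (1 / ε) + Real.log n := by simp [B]
      have hdist := G.sum_abs_independentSetWalk_pow_sub_le hk hkn hkG
      -- For `k = 1` the rate `1 - 1 / k ^ 2` is zero, so one step is exactly uniform.
      have hT1 : T ≤ 1 := hT 1 fun S => (hdist 1 S).trans (by simpa using hε.le)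
      have hT1' : (T : ℝ) ≤ 1 := by exact_mod_cast hT1
      have hcard : (((G.independentSetComplex 1).level 1).card : ℝ) ≤ n := by
        have := G.card_level_le 1
        rw [pow_one] at this
        exact_mod_cast this
      -- At time `0` the bound is `√(N - 1)`, because `0 ^ 0 = 1`.
      have hzero : √((((G.independentSetComplex 1).level 1).card : ℝ) - 1) ≤ ε → (T : ℝ) ≤ B := by
        intro h
        have : T ≤ 0 := hT 0 fun S => (hdist 0 S).trans (by simpa using h)
        rw [Nat.le_zero.1 this]
        exact_mod_cast hB0
      by_cases hn3 : 3 ≤ n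
      · have h3 : (3 : ℝ) ≤ n := by exact_mod_cast hn3
        have : 1 ≤ Real.log n := by
          rw [Real.le_log_iff_exp_le hn0]
          linarith [Real.exp_one_lt_d9]
        linarith
      by_cases hn2 : n = 2
      -- Here `B = log (2 / ε)`, which is at least `1` exactly when `ε ≤ 2 / e`.
      · by_cases hε2 : ε ≤ 2 / Real.exp 1
        · have : 1 ≤ B := by
            rw [hB, ← Real.log_mul (by positivity) hn0.ne',
              Real.le_log_iff_exp_le (by positivity), hn2]
            rw [le_div_iff₀ (Real.exp_pos 1)] at hε2
            rw [one_div, ← div_eq_inv_mul, le_div_iff₀ hε]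
            push_cast
            linarith
          linarith
        · have hε1' : ε = 1 := by
            by_contra hne
            exact hexc ⟨hn2, rfl, not_le.1 hε2, lt_of_le_of_ne hε1 hne⟩
          refine hzero ?_
          rw [hε1', Real.sqrt_le_one]
          have : (n : ℝ) = 2 := by exact_mod_cast hn2
          linarith
      · have hn1' : n = 1 := by
          have : 1 ≤ n := hkn
          omega
        refine hzero ?_
        rw [Real.sqrt_eq_zero_of_nonpos]
        · exact hε.le
        · have : (n : ℝ) = 1 := by exact_mod_cast hn1'
          linarith
    · have hfloor : (⌊B⌋₊ : ℝ) ≤ B := Nat.floor_le hB0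
      refine le_trans ?_ hfloor
      refine Nat.cast_le.2 (hT _ (G.epsClose_of_exp_le hk hkn hkG ?_))
      have hk2' : (2 : ℝ) ≤ k := by exact_mod_cast hk2
      have hn2 : (2 : ℝ) ≤ n := hk2'.trans (by exact_mod_cast hkn)
      have hksq : (4 : ℝ) ≤ (k : ℝ) ^ 2 := by nlinarith
      have h4 : (4 : ℝ) ≤ (n : ℝ) ^ k := by
        calc (4 : ℝ) ≤ (n : ℝ) ^ 2 := by nlinarith
          _ ≤ (n : ℝ) ^ k := pow_le_pow_right₀ hn1 hk2
      -- Rounding `B` down costs at most a factor `e ^ (1 / k ^ 2)`. The unused square root absorbs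
      -- it, since `e ^ (2 / k ^ 2) ≤ e < 4 ≤ n ^ k`.
      have hexp : Real.exp (1 / (k : ℝ) ^ 2) ≤ √((n : ℝ) ^ k) := by
        refine Real.le_sqrt_of_sq_le ?_
        rw [← Real.exp_nat_mul]
        have h5 : ((2 : ℕ) : ℝ) * (1 / (k : ℝ) ^ 2) ≤ 1 := by
          rw [mul_one_div, div_le_one (by positivity)]; push_cast; linarith
        have := Real.exp_le_exp.2 h5
        linarith [Real.exp_one_lt_d9]
      have h6 : Real.exp (-((⌊B⌋₊ : ℝ) / (k : ℝ) ^ 2)) ≤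
          √((n : ℝ) ^ k) * (ε / (n : ℝ) ^ k) := by
        calc _ ≤ Real.exp (1 / (k : ℝ) ^ 2 + -(B / (k : ℝ) ^ 2)) := by
              rw [Real.exp_le_exp, ← sub_eq_add_neg, ← sub_div, ← neg_div]
              gcongr
              linarith [Nat.lt_floor_add_one B]
          _ ≤ _ := by
              rw [Real.exp_add, hexpB]
              gcongr
      calc _ ≤ √((n : ℝ) ^ k) * (√((n : ℝ) ^ k) * (ε / (n : ℝ) ^ k)) := by gcongr
        _ = ε := by
          rw [← mul_assoc, Real.mul_self_sqrt (by positivity)]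
          field_simp
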